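/- Let $q$ be a prime power and let $n$ be a prime power with $q\ge n>2$. Denote by $(v)_{\mathbb F}$ the projective point with homogeneous coordinate vector $v$ over the field $\mathbb F$. Write the points of $\mathrm{PG}(2,q^n)$ as $(a,b,c)_{\mathbb F_{q^n}}$ with $a,b,c\in\mathbb F_{q^n}$, and let $l_\infty$ be the line $c=0$. Write the points of $\mathrm{PG}(2n,q)$ as $(a,b,c)_{\mathbb F_q}$ with $a,b\in\mathbb F_{q^n}$, $c\in\mathbb F_q$, and let $H_\infty$ be the hyperplane $c=0$; points not on $H_\infty$ are called affine. The ABB-map sends $(a,b,1)_{\mathbb F_{q^n}}$ to $(a,b,1)_{\mathbb F_q}$ and $(a,b,0)_{\mathbb F_{q^n}}$ to $\{(ax,bx,0)_{\mathbb F_q}: x\in\mathbb F_{q^n}^*\}$. For a divisor $k$ of $n$, an $\mathbb F_{q^k}$-subline of $\mathrm{PG}(2,q^n)$ is a set $\{(su+tv)_{\mathbb F_{q^n}}: (s,t)\in\mathbb F_{q^k}^2\setminus\{(0,0)\}\}$ with $u,v\in\mathbb F_{q^n}^3$ linearly independent over $\mathbb F_{q^n}$; it is external (respectively tangent) to $l_\infty$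 if it has no point (respectively exactly one point) on $l_\infty$. The smallest of a set of sublines is the one over the smallest field. Let $\mathcal D_k$ be the Desarguesian $(k-1)$-spread of $H_\infty$ with elements $\{(ax,bx,0)_{\mathbb F_q}: x\in\mathbb F_{q^k}^*\}$, $(a,b)\in\mathbb F_{q^n}^2\setminus\{(0,0)\}$. Embed $\mathrm{PG}(2n,q)$ in $\mathrm{PG}(2n,q^n)$ by the map induced by $\iota(a,b,c)=(a,a^q,\dots,a^{q^{n-1}};b,b^q,\dots,b^{q^{n-1}};c)$, and let $\sigma$ be the collineation of $\mathrm{PG}(2n,q^n)$ sending $(a_0,\dots,a_{n-1};b_0,\dots,b_{n-1};c)$ to $(a_{n-1}^q,a_0^q,\dots,a_{n-2}^q;b_{n-1}^q,b_0^q,\dots,b_{n-2}^q;c^q)$. Let $\nu$ be the line consisting of the points all of whose coordinates other than $a_0$ and $b_0$ vanish. The indicator set of $\mathcal D_k$ is $\{\Pi,\Pi^\sigma,\dots,\Pi^{\sigma^{k-1}}\}$, where $\Pi=\langle \nu,\nu^{\sigma^k},\dots,\nu^{\sigma^{n-k}}\rangle\cap\mathrm{Fix}(\sigma^k)$. A normal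 rational curve of degree $r$ in $\mathrm{PG}(2n,q)$ is a set $\mathcal C=\{(\sum_{i=0}^r s^{r-i}t^ie_i)_{\mathbb F_q}: (s,t)\in\mathbb F_q^2\setminus\{(0,0)\}\}$ with $e_0,\dots,e_r$ linearly independent over $\mathbb F_q$; its $\mathbb F_{q^n}$-extension $\mathcal C^*$, for such a parametrisation, is $\{(\sum_{i=0}^r s^{r-i}t^i\iota(e_i))_{\mathbb F_{q^n}}: (s,t)\in\mathbb F_{q^n}^2\setminus\{(0,0)\}\}$. Say that $\mathcal C$ is of type $(*)_r$ if, for some such parametrisation, the points of $\mathcal C^*$ on the members of the indicator set of $\mathcal D_r$ are exactly $r$ distinct conjugate points $Q,Q^\sigma,\dots,Q^{\sigma^{r-1}}$. Let $k$ and $r$ be divisors of $n$, and let $M$ be a set of $q^k+1$ affine points of $\mathrm{PG}(2n,q)$. Then $M$ is the image under the ABB-map of an $\mathbb F_{q^k}$-subline $m$ of $\mathrm{PG}(2,q^n)$ that is external to $l_\infty$ and such that the smallest subline containing $m$ and tangent to $l_\infty$ is an $\mathbb F_{q^r}$-subline, if and only if (i) the point set $M$ spans an $r$-space intersecting $H_\infty$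 in an element of $\mathcal D_r$, and (ii) through every three distinct points of $M$ there is a unique normal rational curve $\mathcal C$ of degree $r$ of type $(*)_r$, and all points of $\mathcal C$ are contained in $M$. -/

import Mathlib

open scoped LinearAlgebra.Projectivization

noncomputable section

namespace ABB

/-! ### Points, subspaces and rational curves in projective spaces -/

section General

variable {R : Type*} [Field R] {V : Type*} [AddCommGroup V] [Module R V]

/-- `v` is a (nonzero) homogeneous coordinate vector of the point `P`, i.e. `P = (v)_R`. -/
def IsCoord (P : ℙ R V) (v : V) : Prop :=
  ∃ h : v ≠ 0, P = Projectivization.mk R v h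

/-- The vector subspace underlying the projective span of a set of points. -/
def spanPts (S : Set (ℙ R V)) : Submodule R V :=
  ⨆ P ∈ S, P.submodule

/-- The point set `{(s^d e_0 + s^(d-1) t e_1 + ⋯ + t^d e_d)_R}`, with `(s, t)` ranging over the
pairs of elements of `R`.  For linearly independent `e_0, …, e_d` it is a normal rational curve
of degree `d`. -/
def ratCurve {d : ℕ} (e : Fin (d + 1) → V) : Set (ℙ R V) :=
  {P | ∃ s t : R, IsCoord P (∑ i : Fin (d + 1), (s ^ (d - (i : ℕ)) * t ^ (i : ℕ)) • e i)}

variable (R) (A : Type*) [AddCommGroup A] [Module R A]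

/-- The hyperplane with equation `c = 0` in the space of triples `(a, b, c)`, `a, b ∈ A`,
`c ∈ R`. -/
def infinity : Submodule R (A × A × R) :=
  LinearMap.ker ((LinearMap.snd R A R) ∘ₗ (LinearMap.snd R A (A × R)))

end General

variable (F K : Type*) [Field F] [Fintype F] [Field K] [Algebra F K]

/-- With `|F| = q` and `n = [K : F]`: the points of `PG(2, q^n)` are the points `(a, b, c)_K`. -/
abbrev Plane : Type _ := ℙ K (K × K × K)

/-- The points of `PG(2n, q)` are the points `(a, b, c)_F` with `a, b ∈ K` and `c ∈ F`. -/
abbrev Space : Type _ := ℙ F (K × K × F)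

/-- Coordinate vectors `(a_0, …, a_{n-1}; b_0, …, b_{n-1}; c)` over `K`. -/
abbrev StarVec : Type _ :=
  (ZMod (Module.finrank F K) → K) × (ZMod (Module.finrank F K) → K) × K

/-- The points of `PG(2n, q^n)`. -/
abbrev StarSpace : Type _ := ℙ K (StarVec F K)

/-! ### The plane over `K`: sublines and their position with respect to the line at infinity -/

/-- `m` is an `𝔽_{q^k}`-subline of `PG(2, q^n)`: the points whose coordinates with respect to two
independent vectors `u, v` can be taken in the subfield of order `q^k`. -/
def IsSubline (k : ℕ) (m : Set (Plane K)) : Prop :=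
  ∃ (E : IntermediateField F K) (u v : K × K × K),
    Module.finrank F E = k ∧ LinearIndependent K ![u, v] ∧
      m = {P | ∃ s t : E, IsCoord P ((s : K) • u + (t : K) • v)}

variable {K} in
/-- `m` has no point on `l_∞`. -/
def IsExternal (m : Set (Plane K)) : Prop :=
  ∀ P ∈ m, ¬ P.submodule ≤ infinity K K

variable {K} in
/-- `m` has exactly one point on `l_∞`. -/
def IsTangent (m : Set (Plane K)) : Prop :=
  ∃! P, P ∈ m ∧ P.submodule ≤ infinity K K

/-- The smallest subline that contains `m` and is tangent to `l_∞` is an `𝔽_{q^r}`-subline. -/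
def SmallestTangentDegree (m : Set (Plane K)) (r : ℕ) : Prop :=
  (∃ m', IsSubline F K r m' ∧ IsTangent m' ∧ m ⊆ m') ∧
    ∀ (j : ℕ) (m' : Set (Plane K)), IsSubline F K j m' → IsTangent m' → m ⊆ m' → r ≤ j

/-! ### The André/Bruck-Bose representation -/

/-- The ABB-map `φ`, which sends `(a, b, 1)_K` to the point `(a, b, 1)_F` and `(a, b, 0)_K` to the
set of the points `(ax, bx, 0)_F`, `x ∈ K*`. -/
def abb (P : Plane K) : Set (Space F K) :=
  {Q | (∃ a b : K, IsCoord P (a, b, 1) ∧ IsCoord Q (a, b, 1)) ∨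
    ∃ a b x : K, IsCoord P (a, b, 0) ∧ x ≠ 0 ∧ IsCoord Q (a * x, b * x, 0)}

/-- The ABB-image of a set of points. -/
def abbImage (m : Set (Plane K)) : Set (Space F K) :=
  ⋃ P ∈ m, abb F K P

/-- `x ↦ (ax, bx, 0)`. -/
def spreadMap (a b : K) : K →ₗ[F] K × K × F :=
  (LinearMap.mulLeft F a).prod ((LinearMap.mulLeft F b).prod 0)

/-- The Desarguesian spread `D_k` of `H_∞`: its elements are the subspaces
`{(ax, bx, 0) | x ∈ 𝔽_{q^k}}` with `(a, b) ≠ (0, 0)`. -/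
def spread (k : ℕ) : Set (Submodule F (K × K × F)) :=
  {S | ∃ (E : IntermediateField F K) (a b : K), Module.finrank F E = k ∧ (a, b) ≠ (0, 0) ∧
    S = E.toSubalgebra.toSubmodule.map (spreadMap F K a b)}

/-! ### The embedding of `PG(2n, q)` in `PG(2n, q^n)` and the indicator set of `D_k` -/

/-- The embedding `ι` of `PG(2n, q)` in `PG(2n, q^n)`, on vectors:
`(a, b, c) ↦ (a, a^q, …, a^(q^(n-1)); b, b^q, …, b^(q^(n-1)); c)`. -/
def emb (v : K × K × F) : StarVec F K :=
  (fun i => v.1 ^ (Fintype.card F) ^ i.val, fun i => v.2.1 ^ (Fintype.card F) ^ i.val,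
    algebraMap F K v.2.2)

/-- The collineation `σ` of `PG(2n, q^n)`, on vectors:
`(a_0, …, a_{n-1}; b_0, …, b_{n-1}; c) ↦ (a_{n-1}^q, a_0^q, …; b_{n-1}^q, b_0^q, …; c^q)`. -/
def sigmaVec : StarVec F K →ₛₗ[(FiniteField.frobeniusAlgHom F K : K →+* K)] StarVec F K where
  toFun v := (fun i => v.1 (i - 1) ^ Fintype.card F, fun i => v.2.1 (i - 1) ^ Fintype.card F,
    v.2.2 ^ Fintype.card F)
  map_add' v w := by
    have h : ∀ x y : K, (x + y) ^ Fintype.card F = x ^ Fintype.card F + y ^ Fintype.card F :=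
      fun x y => map_add (FiniteField.frobeniusAlgHom F K) x y
    ext <;> simp [h]
  map_smul' c v := by
    ext <;> simp [mul_pow]

theorem sigmaVec_injective : Function.Injective (sigmaVec F K) := by
  have h : ∀ x y : K, x ^ Fintype.card F = y ^ Fintype.card F → x = y :=
    fun x y hxy => (FiniteField.frobeniusAlgHom F K).toRingHom.injective hxy
  rintro ⟨a, b, c⟩ ⟨a', b', c'⟩ hv
  simp only [sigmaVec, LinearMap.coe_mk, AddHom.coe_mk, Prod.mk.injEq] at hv
  obtain ⟨ha, hb, hc⟩ := hv
  refine Prod.ext (funext fun i => ?_) (Prod.ext (funext fun i => ?_) (h _ _ hc))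
  · simpa using h _ _ (congrFun ha (i + 1))
  · simpa using h _ _ (congrFun hb (i + 1))

/-- The collineation `σ` on points. -/
def sigma : StarSpace F K → StarSpace F K :=
  Projectivization.map (sigmaVec F K) (sigmaVec_injective F K)

/-- The points of the line `ν`, spanned by `(1, 0, …, 0; 0, …, 0; 0)` and
`(0, …, 0; 1, 0, …, 0; 0)`. -/
def nu : Set (StarSpace F K) :=
  {P | ∃ a b : K, IsCoord P (Pi.single 0 a, Pi.single 0 b, 0)}

/-- The subgeometry `Π = ⟨ν, ν^(σ^k), …, ν^(σ^(n-k))⟩ ∩ Fix(σ^k)`. -/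
def directorSpace (k : ℕ) : Set (StarSpace F K) :=
  {P | P.submodule ≤ spanPts (⋃ j ∈ Set.Iio (Module.finrank F K / k), (sigma F K)^[k * j] '' nu F K)
    ∧ (sigma F K)^[k] P = P}

/-- The points on the members of the indicator set `{Π, Π^σ, …, Π^(σ^(k-1))}` of `D_k`. -/
def indicatorPoints (k : ℕ) : Set (StarSpace F K) :=
  ⋃ i ∈ Set.Iio k, (sigma F K)^[i] '' directorSpace F K k

/-- The set `S` of points of `PG(2n, q^n)` meets the indicator set of `D_k` in `k` (distinct)
conjugate points `Q, Q^σ, …, Q^(σ^(k-1))`. -/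
def MeetsIndicator (k : ℕ) (S : Set (StarSpace F K)) : Prop :=
  ∃ Q : StarSpace F K, Set.InjOn (fun i : ℕ => (sigma F K)^[i] Q) (Set.Iio k) ∧
    S ∩ indicatorPoints F K k = (fun i : ℕ => (sigma F K)^[i] Q) '' Set.Iio k

/-- `C` is a normal rational curve of degree `r` in `PG(2n, q)` whose extension to `PG(2n, q^n)`
meets the indicator set of `D_r` in `r` conjugate points.  The extension of a curve is obtained by
letting the parameters of the curve range over `K` instead of `F`. -/
def IsSpecialCurve (r : ℕ) (C : Set (Space F K)) : Prop :=
  ∃ e : Fin (r + 1) → K × K × F, LinearIndependent F e ∧ C = ratCurve e ∧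
    MeetsIndicator F K r (ratCurve (fun i => emb F K (e i)))

/-- `M` spans an `r`-space that meets `H_∞` in an element of `D_r`. -/
def SpansOverSpread (r : ℕ) (M : Set (Space F K)) : Prop :=
  Module.finrank F (spanPts M) = r + 1 ∧ spanPts M ⊓ infinity F K ∈ spread F K r

/-- Every three points of `M` determine a normal rational curve of degree `r` whose extension
meets the indicator set of `D_r` in `r` conjugate points, and all points of this curve lie
in `M`. -/
def CurveClosed (r : ℕ) (M : Set (Space F K)) : Prop :=
  ∀ A ∈ M, ∀ B ∈ M, ∀ D ∈ M, A ≠ B → A ≠ D → B ≠ D →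
    ∃ C, (IsSpecialCurve F K r C ∧ {A, B, D} ⊆ C) ∧ C ⊆ M ∧
      ∀ C', IsSpecialCurve F K r C' ∧ {A, B, D} ⊆ C' → C' = C

end ABB

end

/-!
Let `η` be the parameter of the point at infinity `(η u + v)_K` of the line of an `E`-subline with
coordinate vectors `u, v`, where `(u)_K` is affine. The subline is tangent if `η ∈ E` and external
otherwise. As `n` is a prime power, the fields between `F` and `K` form a chain, so `E ≤ F(η)` for
an external subline and the smallest tangent subline containing it is an `F(η)`-subline: `r` is the
degree of the minimal polynomial `f` of `η`. The differences of points of the image of the subline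
are governed by the inverses of `c - η`, which span `F(η)` for `c ∈ F` as soon as `r ≤ q`; this is
condition (i).

The points of an external `F`-subline are the values of `(f / (X - η)) (X u + v)`, whose
coefficients are the vectors `e_0, …, e_r` of a normal rational curve of degree `r`; the extension
of this curve meets the indicator set of `D_r` exactly in the points whose parameters are the
conjugates of `η`. Conversely, the parameter of a point of intersection has `r` conjugates, and the
coordinate polynomials of the curve vanish at all of them but one, so they are multiples of
`f / (X - η)`. Hence the curves of type `(*)_r` with an affine point are the images of the external
`F`-sublines with tangent degree `r`.

Finally, for `q > 2` a set of points closed under `F`-sublines through triples of its points is a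
subline: in coordinates it is an `F`-subspace of `K` containing `1` and closed under inversion,
hence a field, by Hua's identity.
-/

noncomputable section

namespace ABB

section Coordinates

variable {R : Type*} [Field R] {V : Type*} [AddCommGroup V] [Module R V]

theorem IsCoord.ne_zero {P : ℙ R V} {v : V} (h : IsCoord P v) : v ≠ 0 := h.1

theorem isCoord_mk {v : V} (h : v ≠ 0) : IsCoord (Projectivization.mk R v h) v := ⟨h, rfl⟩

theorem exists_isCoord (P : ℙ R V) : ∃ v, IsCoord P v :=
  ⟨P.rep, P.rep_nonzero, P.mk_rep.symm⟩

theorem IsCoord.submodule_eq {P : ℙ R V} {v : V} (h : IsCoord P v) :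
    P.submodule = Submodule.span R {v} := by
  obtain ⟨h, rfl⟩ := h
  rfl

theorem IsCoord.submodule_le_iff {P : ℙ R V} {v : V} (h : IsCoord P v) {W : Submodule R V} :
    P.submodule ≤ W ↔ v ∈ W := by
  rw [h.submodule_eq, Submodule.span_singleton_le_iff_mem]

theorem IsCoord.unique {P Q : ℙ R V} {v : V} (h : IsCoord P v) (h' : IsCoord Q v) : P = Q := by
  obtain ⟨_, rfl⟩ := h
  obtain ⟨_, rfl⟩ := h'
  rfl

theorem IsCoord.exists_smul {P : ℙ R V} {v w : V} (h : IsCoord P v) (h' : IsCoord P w) :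
    ∃ c : R, c ≠ 0 ∧ w = c • v := by
  obtain ⟨hv, rfl⟩ := h
  obtain ⟨hw, e⟩ := h'
  obtain ⟨a, ha⟩ := (Projectivization.mk_eq_mk_iff R _ _ hw hv).1 e.symm
  exact ⟨a, a.ne_zero, ha.symm⟩

theorem IsCoord.smul {P : ℙ R V} {v : V} (h : IsCoord P v) {c : R} (hc : c ≠ 0) :
    IsCoord P (c • v) := by
  obtain ⟨hv, rfl⟩ := h
  refine ⟨smul_ne_zero hc hv, ?_⟩
  rw [Projectivization.mk_eq_mk_iff']
  exact ⟨c⁻¹, by rw [smul_smul, inv_mul_cancel₀ hc, one_smul]⟩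

theorem isCoord_smul_iff {P : ℙ R V} {v : V} {c : R} (hc : c ≠ 0) :
    IsCoord P (c • v) ↔ IsCoord P v := by
  refine ⟨fun h => ?_, fun h => h.smul hc⟩
  simpa [smul_smul, inv_mul_cancel₀ hc] using h.smul (inv_ne_zero hc)

theorem IsCoord.eq_of_smul_eq {P Q : ℙ R V} {x y : V} (hP : IsCoord P x) (hQ : IsCoord Q y)
    {a b : R} (ha : a ≠ 0) (h : a • y = b • x) : P = Q := by
  have hb : b ≠ 0 := by
    rintro rfl
    exact smul_ne_zero ha hQ.ne_zero (h.trans (zero_smul R x))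
  exact (hP.smul hb).unique (h ▸ hQ.smul ha)

theorem IsCoord.linearIndependent_pair {P Q : ℙ R V} {x y : V} (hP : IsCoord P x)
    (hQ : IsCoord Q y) (h : P ≠ Q) : LinearIndependent R ![x, y] :=
  (LinearIndependent.pair_iff' hP.ne_zero).2 fun _ hxy =>
    h (hP.eq_of_smul_eq hQ one_ne_zero ((one_smul R y).trans hxy.symm))

theorem IsCoord.ne_of_pair {P Q : ℙ R V} {x y : V} (hP : IsCoord P x)
    (h : LinearIndependent R ![x, y]) (hQ : IsCoord Q y) : P ≠ Q := by
  rintro rfl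
  obtain ⟨c, -, hc⟩ := hP.exists_smul hQ
  exact (LinearIndependent.pair_iff' hP.ne_zero).1 h c hc.symm

theorem smul_add_ne_zero_of_pair {u v : V} (h : LinearIndependent R ![u, v]) (c : R) :
    c • u + v ≠ 0 := fun h0 => by
  simpa using (LinearIndependent.pair_iff.1 h c 1 (by simpa using h0)).2

theorem add_ne_zero_of_pair {u v : V} (h : LinearIndependent R ![u, v]) : u + v ≠ 0 := by
  simpa using smul_add_ne_zero_of_pair h 1

theorem IsCoord.not_smul_add {P : ℙ R V} {u v : V} (hP : IsCoord P u)
    (h : LinearIndependent R ![u, v]) (c : R) : ¬ IsCoord P (c • u + v) := fun hPc =>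
  hP.ne_of_pair (by
    simpa using (LinearIndependent.pair_add_smul_add_smul_iff 1 0 c 1).2 ⟨h, by simp⟩) hPc rfl

theorem IsCoord.smul_add_unique {P : ℙ R V} {u v : V} {c d : R} (hc : IsCoord P (c • u + v))
    (hd : IsCoord P (d • u + v)) (h : LinearIndependent R ![u, v]) : c = d := by
  obtain ⟨a, -, ha⟩ := hc.exists_smul hd
  obtain ⟨h₁, h₂⟩ := LinearIndependent.pair_iff.1 h (d - a * c) (1 - a)
    (by linear_combination (norm := module) ha)
  linear_combination c * h₂ - h₁

end Coordinates

section Subline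

variable {F K : Type*} [Field F] [Field K] [Algebra F K] {V : Type*} [AddCommGroup V] [Module K V]

/-- The points with coordinates in the subfield `E` with respect to `u` and `v`: an `E`-subline
when `u` and `v` are independent. -/
def subline (E : IntermediateField F K) (u v : V) : Set (ℙ K V) :=
  {P | ∃ s t : E, IsCoord P ((s : K) • u + (t : K) • v)}

variable {E : IntermediateField F K} {u v : V}

theorem mem_subline_iff {P : ℙ K V} :
    P ∈ subline E u v ↔ IsCoord P u ∨ ∃ c ∈ E, IsCoord P (c • u + v) := by
  constructor
  · rintro ⟨s, t, hP⟩
    by_cases ht : (t : K) = 0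
    · rw [ht, zero_smul, add_zero] at hP
      exact Or.inl ((isCoord_smul_iff fun hs => hP.ne_zero (by rw [hs, zero_smul])).1 hP)
    · refine Or.inr ⟨s / t, E.div_mem s.2 t.2, (isCoord_smul_iff ht).1 ?_⟩
      rwa [smul_add, smul_smul, mul_div_cancel₀ _ ht]
  · rintro (hP | ⟨c, hc, hP⟩)
    · exact ⟨1, 0, by simpa using hP⟩
    · exact ⟨⟨c, hc⟩, 1, by simpa using hP⟩

theorem subline_mono {E' : IntermediateField F K} (h : E ≤ E') : subline E u v ⊆ subline E' u v :=
  fun _ ⟨s, t, hP⟩ => ⟨⟨s, h s.2⟩, ⟨t, h t.2⟩, hP⟩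

theorem smul_add_mem_subline_iff (h : LinearIndependent K ![u, v]) {P : ℙ K V} {c : K}
    (hP : IsCoord P (c • u + v)) : P ∈ subline E u v ↔ c ∈ E := by
  refine ⟨fun hPE => ?_, fun hc => mem_subline_iff.2 (.inr ⟨c, hc, hP⟩)⟩
  obtain hPu | ⟨d, hd, hPd⟩ := mem_subline_iff.1 hPE
  · exact absurd hP (hPu.not_smul_add h c)
  · exact hPd.smul_add_unique hP h ▸ hd

theorem subline_subset_subline_iff {E' : IntermediateField F K} (h : LinearIndependent K ![u, v]) :
    subline E u v ⊆ subline E' u v ↔ E ≤ E' := by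
  refine ⟨fun hsub c hc => ?_, subline_mono⟩
  have hP := isCoord_mk (R := K) (smul_add_ne_zero_of_pair h c)
  exact (smul_add_mem_subline_iff h hP).1 (hsub ((smul_add_mem_subline_iff h hP).2 hc))

theorem subline_smul {c : K} (hc : c ≠ 0) : subline E (c • u) (c • v) = subline E u v := by
  ext P
  simp only [subline, Set.mem_ofPred_eq, smul_comm _ c, ← smul_add, isCoord_smul_iff hc]

theorem subline_linearCombination {a b c d : E} (h : a * d - b * c ≠ 0) :
    subline E ((a : K) • u + (b : K) • v) ((c : K) • u + (d : K) • v) = subline E u v := by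
  have hK : (a * d - b * c : K) ≠ 0 := by exact_mod_cast h
  ext P
  constructor
  · rintro ⟨s, t, hP⟩
    refine ⟨s * a + t * c, s * b + t * d, ?_⟩
    convert hP using 1
    push_cast
    module
  · rintro ⟨s, t, hP⟩
    refine ⟨s * d - t * c, t * a - s * b, ?_⟩
    convert hP.smul hK using 1
    push_cast
    module

theorem subline_eq_of_frame {u' v' : V} (h : LinearIndependent K ![u, v])
    (h' : LinearIndependent K ![u', v']) {P Q T : ℙ K V} (hP : IsCoord P u') (hQ : IsCoord Q v')
    (hT : IsCoord T (u' + v')) (hPm : P ∈ subline E u v) (hQm : Q ∈ subline E u v)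
    (hTm : T ∈ subline E u v) : subline E u v = subline E u' v' := by
  obtain ⟨s₁, t₁, h₁⟩ := hPm
  obtain ⟨s₂, t₂, h₂⟩ := hQm
  obtain ⟨s₃, t₃, h₃⟩ := hTm
  have hdet : (s₁ * t₂ - t₁ * s₂ : K) ≠ 0 :=
    sub_ne_zero.2 (LinearIndependent.pair_add_smul_add_smul_iff _ _ _ _ |>.1
      (h₁.linearIndependent_pair h₂ (hP.ne_of_pair h' hQ))).2
  obtain ⟨α, hα, rfl⟩ := h₁.exists_smul hP
  obtain ⟨β, hβ, rfl⟩ := h₂.exists_smul hQ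
  obtain ⟨γ, hγ, hsum⟩ := h₃.exists_smul hT
  obtain ⟨hs, ht⟩ := LinearIndependent.pair_iff.1 h (α * s₁ + β * s₂ - γ * s₃)
    (α * t₁ + β * t₂ - γ * t₃) (by linear_combination (norm := module) hsum)
  have hα' : α = γ / (s₁ * t₂ - t₁ * s₂) * (s₃ * t₂ - t₃ * s₂) := by
    field_simp
    linear_combination t₂ * hs - s₂ * ht
  have hβ' : β = γ / (s₁ * t₂ - t₁ * s₂) * (s₁ * t₃ - t₁ * s₃) := by
    field_simp
    linear_combination s₁ * ht - t₁ * hs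
  have hdet' : (s₃ * t₂ - t₃ * s₂) * s₁ * ((s₁ * t₃ - t₁ * s₃) * t₂) -
      (s₃ * t₂ - t₃ * s₂) * t₁ * ((s₁ * t₃ - t₁ * s₃) * s₂) ≠ 0 := by
    have hABdet := mul_ne_zero (mul_ne_zero (right_ne_zero_of_mul (hα' ▸ hα))
      (right_ne_zero_of_mul (hβ' ▸ hβ))) hdet
    have hring : ∀ A B : E, A * s₁ * (B * t₂) - A * t₁ * (B * s₂) =
        A * B * (s₁ * t₂ - t₁ * s₂) := fun A B => by ring
    rw [hring]
    exact_mod_cast hABdet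
  rw [hα', hβ', mul_smul, mul_smul, subline_smul (div_ne_zero hγ hdet),
    ← subline_linearCombination hdet']
  push_cast
  simp only [smul_add, mul_smul]

theorem subline_eq_of_subset {E' : IntermediateField F K} {u' v' : V}
    (h : LinearIndependent K ![u, v]) (h' : LinearIndependent K ![u', v'])
    (hsub : subline E u v ⊆ subline E' u' v') : subline E' u' v' = subline E' u v := by
  have hP := isCoord_mk (R := K) (h.ne_zero 0)
  have hQ := isCoord_mk (R := K) (h.ne_zero 1)
  have hT := isCoord_mk (R := K) (add_ne_zero_of_pair h)
  exact subline_eq_of_frame h' h hP hQ hT (hsub ⟨1, 0, by simpa using hP⟩)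
    (hsub ⟨0, 1, by simpa using hQ⟩) (hsub ⟨1, 1, by simpa using hT⟩)

theorem exists_frame {P Q T : ℙ K V} (h : LinearIndependent K ![u, v]) (hP : P ∈ subline E u v)
    (hQ : Q ∈ subline E u v) (hT : T ∈ subline E u v) (hPQ : P ≠ Q) (hPT : P ≠ T) (hQT : Q ≠ T) :
    ∃ u' v', LinearIndependent K ![u', v'] ∧ IsCoord P u' ∧ IsCoord Q v' ∧ IsCoord T (u' + v') ∧
      subline E u v = subline E u' v' := by
  obtain ⟨s₁, t₁, h₁⟩ := id hP
  obtain ⟨s₂, t₂, h₂⟩ := id hQ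
  obtain ⟨s₃, t₃, h₃⟩ := id hT
  have hdet {s s' t t' : E} {A B : ℙ K V} (hA : IsCoord A ((s : K) • u + (t : K) • v))
      (hB : IsCoord B ((s' : K) • u + (t' : K) • v)) (hAB : A ≠ B) : (s * t' - t * s' : K) ≠ 0 :=
    sub_ne_zero.2 (LinearIndependent.pair_add_smul_add_smul_iff _ _ _ _ |>.1
      (hA.linearIndependent_pair hB hAB)).2
  have hu := h₁.smul (hdet h₃ h₂ hQT.symm)
  have hv := h₂.smul (hdet h₁ h₃ hPT)
  have huv := h₃.smul (hdet h₁ h₂ hPQ)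
  have hsum : (s₁ * t₂ - t₁ * s₂ : K) • ((s₃ : K) • u + (t₃ : K) • v) =
      (s₃ * t₂ - t₃ * s₂ : K) • ((s₁ : K) • u + (t₁ : K) • v) +
        (s₁ * t₃ - t₁ * s₃ : K) • ((s₂ : K) • u + (t₂ : K) • v) := by
    module
  rw [hsum] at huv
  have h' := hu.linearIndependent_pair hv hPQ
  exact ⟨_, _, h', hu, hv, huv, subline_eq_of_frame h h' hu hv huv hP hQ hT⟩

theorem subline_eq_of_three_mem {u' v' : V} {P Q T : ℙ K V} (h : LinearIndependent K ![u, v])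
    (h' : LinearIndependent K ![u', v']) (hP : P ∈ subline E u v) (hQ : Q ∈ subline E u v)
    (hT : T ∈ subline E u v) (hP' : P ∈ subline E u' v') (hQ' : Q ∈ subline E u' v')
    (hT' : T ∈ subline E u' v') (hPQ : P ≠ Q) (hPT : P ≠ T) (hQT : Q ≠ T) :
    subline E u v = subline E u' v' := by
  obtain ⟨x, y, hxy, hx, hy, hz, e⟩ := exists_frame h hP hQ hT hPQ hPT hQT
  rw [e, subline_eq_of_frame h' hxy hx hy hz hP' hQ' hT']

theorem ncard_subline [Finite E] (h : LinearIndependent K ![u, v]) :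
    (subline E u v).ncard = Nat.card E + 1 := by
  let point (c : E) : ℙ K V := .mk K ((c : K) • u + v) (smul_add_ne_zero_of_pair h _)
  have hpoint (c : E) : IsCoord (point c) ((c : K) • u + v) := isCoord_mk _
  let P : ℙ K V := .mk K u (h.ne_zero 0)
  have hP : IsCoord P u := isCoord_mk _
  have hinsert : subline E u v = insert P (Set.range point) := by
    ext Q
    rw [mem_subline_iff, Set.mem_insert_iff, Set.mem_range]
    refine or_congr ⟨fun hQ => hQ.unique hP, fun hQ => hQ ▸ hP⟩ ⟨?_, ?_⟩
    · rintro ⟨c, hc, hQ⟩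
      exact ⟨⟨c, hc⟩, (hpoint _).unique hQ⟩
    · rintro ⟨c, rfl⟩
      exact ⟨c, c.2, hpoint c⟩
  have hnotMem : P ∉ Set.range point := by
    rintro ⟨c, hc⟩
    exact hP.not_smul_add h c (hc ▸ hpoint c)
  have hinj : Function.Injective point := fun c d hcd =>
    Subtype.ext ((hpoint c).smul_add_unique (hcd ▸ hpoint d) h)
  rw [hinsert, Set.ncard_insert_of_notMem hnotMem, ← Set.image_univ,
    Set.ncard_image_of_injective _ hinj, Set.ncard_univ]

end Subline

section LineClosed

variable {F : Type*} [Field F] {W : Type*} [AddCommGroup W] [Module F W]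

variable (F) in
/-- `S` contains the `F`-line through any two of its points. -/
def LineClosed (S : Set W) : Prop :=
  ∀ c ∈ S, ∀ d ∈ S, ∀ x : F, c + x • (d - c) ∈ S

theorem LineClosed.exists_submodule {S : Set W} (hS : LineClosed F S) (h0 : (0 : W) ∈ S) {y : F}
    (hy0 : y ≠ 0) (hy1 : y ≠ 1) : ∃ U : Submodule F W, (U : Set W) = S := by
  have hsmul : ∀ (x : F) {d : W}, d ∈ S → x • d ∈ S := fun x d hd => by simpa using hS 0 h0 d hd x
  have hadd : ∀ {c d : W}, c ∈ S → d ∈ S → c + d ∈ S := fun {c d} hc hd => by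
    have hy1' : 1 - y ≠ 0 := sub_ne_zero.2 hy1.symm
    convert hS _ (hsmul (1 - y)⁻¹ hc) _ (hsmul y⁻¹ hd) y using 1
    match_scalars <;> field_simp
    ring
  exact ⟨⟨⟨⟨S, hadd⟩, h0⟩, fun x _ => hsmul x⟩, rfl⟩

end LineClosed

section InverseClosed

variable {K : Type*} [Field K]

theorem inv_mem_of_addSubgroup_inv {W W' : AddSubgroup K} (h : ∀ c, c ∈ W' ↔ c⁻¹ ∈ W)
    (h1 : (1 : K) ∈ W) {d : K} (hd : d ∈ W) : d⁻¹ ∈ W := by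
  by_cases hd0 : d = 0
  · simp [hd0]
  by_cases hd1 : d - 1 = 0
  · simpa [sub_eq_zero.1 hd1] using h1
  have hW' : 1 + (d - 1)⁻¹ ∈ W' :=
    W'.add_mem ((h _).2 (by simpa using h1)) ((h _).2 (by simpa using W.sub_mem hd h1))
  have hinv : d⁻¹ = 1 - (1 + (d - 1)⁻¹)⁻¹ := by
    have hsum : 1 + (d - 1)⁻¹ = d / (d - 1) := by field_simp; ring
    rw [hsum]
    field_simp
    ring
  exact hinv ▸ W.sub_mem h1 ((h _).1 hW')

variable {W : AddSubgroup K} (hinv : ∀ c ∈ W, c⁻¹ ∈ W)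

include hinv

theorem sq_mul_mem_of_inv_mem {c d : K} (hc : c ∈ W) (hd : d ∈ W) : c ^ 2 * d ∈ W := by
  by_cases hc0 : c = 0
  · simp [hc0]
  by_cases hd0 : d = 0
  · simp [hd0]
  by_cases hcd : 1 - c * d = 0
  · have : c ^ 2 * d = c := by linear_combination -c * hcd
    rwa [this]
  have hua : c ^ 2 * d = c - (c⁻¹ + (d⁻¹ - c)⁻¹)⁻¹ := by
    have h₁ : d⁻¹ - c = (1 - c * d) / d := by field_simp
    have h₂ : c⁻¹ + d / (1 - c * d) = (c * (1 - c * d))⁻¹ := by field_simp; ring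
    rw [h₁, inv_div, h₂, inv_inv]
    ring
  rw [hua]
  exact W.sub_mem hc (hinv _ (W.add_mem (hinv _ hc) (hinv _ (W.sub_mem (hinv _ hd) hc))))

theorem mul_mem_of_inv_mem [Finite K] (h1 : (1 : K) ∈ W) {c d : K} (hc : c ∈ W) (hd : d ∈ W) :
    c * d ∈ W := by
  by_cases htwo : (2 : K) = 0
  · have hsq : ∀ x : W, (x : K) ^ 2 ∈ W := fun x => by
      simpa using sq_mul_mem_of_inv_mem hinv x.2 h1
    have hinj : Function.Injective fun x : W => (⟨(x : K) ^ 2, hsq x⟩ : W) := fun x y hxy => by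
      have hxy : (x : K) ^ 2 = (y : K) ^ 2 := congrArg Subtype.val hxy
      have : ((x : K) - y) ^ 2 = 0 := by linear_combination hxy + (y ^ 2 - x * y : K) * htwo
      exact Subtype.ext (sub_eq_zero.1 (pow_eq_zero_iff two_ne_zero |>.1 this))
    obtain ⟨b, hb⟩ := Finite.surjective_of_injective hinj ⟨c, hc⟩
    have hb : (b : K) ^ 2 = c := congrArg Subtype.val hb
    exact hb ▸ sq_mul_mem_of_inv_mem hinv b.2 hd
  · have hhalf : ∀ x ∈ W, x / 2 ∈ W := fun x hx => by
      have h := hinv _ (W.add_mem (hinv x hx) (hinv x hx))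
      rwa [← two_mul, mul_inv, inv_inv, mul_comm, ← div_eq_mul_inv] at h
    have hpolar : c * d = ((c + 1) ^ 2 * d - c ^ 2 * d - d) / 2 := by
      field_simp
      ring
    rw [hpolar]
    exact hhalf _ (W.sub_mem (W.sub_mem (sq_mul_mem_of_inv_mem hinv (W.add_mem hc h1) hd)
      (sq_mul_mem_of_inv_mem hinv hc hd)) hd)

omit hinv

theorem exists_intermediateField_of_inv_mem {F : Type*} [Field F] [Algebra F K] [Finite K]
    {W : Submodule F K} (h1 : (1 : K) ∈ W) (hinv : ∀ c ∈ W, c⁻¹ ∈ W) :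
    ∃ E : IntermediateField F K, (E : Set K) = W :=
  ⟨{ carrier := W
     mul_mem' := mul_mem_of_inv_mem (W := W.toAddSubgroup) hinv h1
     add_mem' := W.add_mem
     algebraMap_mem' := fun x => by simpa [Algebra.smul_def] using W.smul_mem x h1
     inv_mem' := hinv }, rfl⟩

end InverseClosed

section SublineClosed

variable {F K : Type*} [Field F] [Field K] [Algebra F K] {V : Type*} [AddCommGroup V] [Module K V]

variable (F) in
/-- Every three distinct points of `m` lie on an `F`-subline contained in `m`. -/
def IsSublineClosed (m : Set (ℙ K V)) : Prop :=
  ∀ P ∈ m, ∀ Q ∈ m, ∀ T ∈ m, P ≠ Q → P ≠ T → Q ≠ T → ∃ u v, LinearIndependent K ![u, v] ∧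
    {P, Q, T} ⊆ subline (⊥ : IntermediateField F K) u v ∧
      subline (⊥ : IntermediateField F K) u v ⊆ m

namespace IsSublineClosed

variable {m : Set (ℙ K V)} {u v : V} {P Q T : ℙ K V}

theorem exists_frame (hm : IsSublineClosed F m) (hP : P ∈ m) (hQ : Q ∈ m) (hT : T ∈ m)
    (hPQ : P ≠ Q) (hPT : P ≠ T) (hQT : Q ≠ T) : ∃ u v, LinearIndependent K ![u, v] ∧
      IsCoord P u ∧ IsCoord Q v ∧ IsCoord T (u + v) ∧
        subline (⊥ : IntermediateField F K) u v ⊆ m := by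
  obtain ⟨u, v, huv, hsub, hle⟩ := hm P hP Q hQ T hT hPQ hPT hQT
  simp only [Set.insert_subset_iff, Set.singleton_subset_iff] at hsub
  obtain ⟨u', v', huv', hPu, hQv, hTuv, e⟩ :=
    ABB.exists_frame huv hsub.1 hsub.2.1 hsub.2.2 hPQ hPT hQT
  exact ⟨u', v', huv', hPu, hQv, hTuv, e ▸ hle⟩

theorem subline_subset (hm : IsSublineClosed F m) (h : LinearIndependent K ![u, v])
    (hPu : IsCoord P u) (hQv : IsCoord Q v) (hTuv : IsCoord T (u + v)) (hP : P ∈ m) (hQ : Q ∈ m)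
    (hT : T ∈ m) : subline (⊥ : IntermediateField F K) u v ⊆ m := by
  have hPT : P ≠ T := hPu.ne_of_pair (by simpa using h) hTuv
  have hQT : Q ≠ T := hQv.ne_of_pair (by
    rw [add_comm]
    simpa using LinearIndependent.pair_symm_iff.1 h) hTuv
  obtain ⟨u', v', huv', hsub, hle⟩ := hm P hP Q hQ T hT (hPu.ne_of_pair h hQv) hPT hQT
  simp only [Set.insert_subset_iff, Set.singleton_subset_iff] at hsub
  rwa [subline_eq_of_frame huv' h hPu hQv hTuv hsub.1 hsub.2.1 hsub.2.2] at hle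

theorem lineClosed (hm : IsSublineClosed F m) (h : LinearIndependent K ![u, v])
    (hPu : IsCoord P u) (hP : P ∈ m) : LineClosed F {c : K | ∃ Q ∈ m, IsCoord Q (c • u + v)} := by
  rintro c ⟨Q, hQ, hQc⟩ d ⟨T, hT, hTd⟩ x
  by_cases hcd : d - c = 0
  · exact ⟨Q, hQ, by simpa [hcd] using hQc⟩
  have h' : LinearIndependent K ![(d - c) • u, c • u + v] := by
    simpa using (LinearIndependent.pair_add_smul_add_smul_iff (d - c) 0 c 1).2
      ⟨h, by simpa using hcd⟩
  have hsub : subline (⊥ : IntermediateField F K) ((d - c) • u) (c • u + v) ⊆ m :=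
    hm.subline_subset h' (hPu.smul hcd) hQc (by convert hTd using 1; module) hP hQ hT
  have hx : algebraMap F K x • (d - c) • u + (c • u + v) = (c + x • (d - c)) • u + v := by
    rw [Algebra.smul_def]
    module
  have hne := smul_add_ne_zero_of_pair h (c + x • (d - c))
  exact ⟨.mk K _ hne, hsub (mem_subline_iff.2 (.inr ⟨algebraMap F K x,
    IntermediateField.algebraMap_mem _ x, hx.symm ▸ isCoord_mk hne⟩)), isCoord_mk hne⟩

theorem exists_intermediateField [Finite K] {y : F} (hy0 : y ≠ 0) (hy1 : y ≠ 1)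
    (hm : IsSublineClosed F m) (h : LinearIndependent K ![u, v]) (hPu : IsCoord P u)
    (hQv : IsCoord Q v) (hTuv : IsCoord T (u + v)) (hP : P ∈ m) (hQ : Q ∈ m) (hT : T ∈ m) :
    ∃ E : IntermediateField F K, ∀ c, c ∈ E ↔ ∃ A ∈ m, IsCoord A (c • u + v) := by
  obtain ⟨W, hW⟩ := (hm.lineClosed h hPu hP).exists_submodule ⟨Q, hQ, by simpa using hQv⟩ hy0 hy1
  obtain ⟨W', hW'⟩ := (hm.lineClosed (LinearIndependent.pair_symm_iff.1 h) hQv hQ).exists_submodule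
    ⟨P, hP, by simpa using hPu⟩ hy0 hy1
  have hmem (c : K) : c ∈ W ↔ ∃ A ∈ m, IsCoord A (c • u + v) := by
    rw [← SetLike.mem_coe, hW, Set.mem_ofPred_eq]
  have hmem' (c : K) : c ∈ W' ↔ ∃ A ∈ m, IsCoord A (c • v + u) := by
    rw [← SetLike.mem_coe, hW', Set.mem_ofPred_eq]
  have hinv (c : K) : c ∈ W' ↔ c⁻¹ ∈ W := by
    by_cases hc : c = 0
    · simp [hc]
    rw [hmem, hmem']
    refine exists_congr fun A => and_congr_right fun _ => ?_
    rw [← isCoord_smul_iff (v := c⁻¹ • u + v) hc, smul_add, smul_smul, mul_inv_cancel₀ hc,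
      one_smul, add_comm]
  have h1 : (1 : K) ∈ W := (hmem 1).2 ⟨T, hT, by simpa using hTuv⟩
  obtain ⟨E, hE⟩ := exists_intermediateField_of_inv_mem h1 fun c =>
    inv_mem_of_addSubgroup_inv (W := W.toAddSubgroup) (W' := W'.toAddSubgroup) hinv h1
  exact ⟨E, fun c => by rw [← hmem, ← SetLike.mem_coe, hE, SetLike.mem_coe]⟩

theorem exists_isCoord_smul_add (hm : IsSublineClosed F m) (hPu : IsCoord P u) (hQv : IsCoord Q v)
    (hP : P ∈ m) (hQ : Q ∈ m) (hT : T ∈ m) (hPQ : P ≠ Q) (hPT : P ≠ T) :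
    ∃ c : K, IsCoord T (c • u + v) := by
  by_cases hQT : Q = T
  · exact ⟨0, by simpa [← hQT] using hQv⟩
  obtain ⟨u', v', -, hPu', hQv', hT', -⟩ := hm.exists_frame hP hQ hT hPQ hPT hQT
  obtain ⟨a, -, rfl⟩ := hPu.exists_smul hPu'
  obtain ⟨b, hb, rfl⟩ := hQv.exists_smul hQv'
  refine ⟨b⁻¹ * a, ?_⟩
  convert hT'.smul (inv_ne_zero hb) using 1
  match_scalars <;> field_simp

theorem exists_eq_subline [Finite K] {y : F} (hy0 : y ≠ 0) (hy1 : y ≠ 1) (hm : IsSublineClosed F m)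
    (hcard : 2 < m.ncard) : ∃ (E : IntermediateField F K) (u v : V),
      LinearIndependent K ![u, v] ∧ m = subline E u v := by
  obtain ⟨P, Q, T, hP, hQ, hT, hPQ, hPT, hQT⟩ :=
    (Set.two_lt_ncard_iff (Set.finite_of_ncard_pos (by lia))).1 hcard
  obtain ⟨u, v, huv, hPu, hQv, hTuv, -⟩ := hm.exists_frame hP hQ hT hPQ hPT hQT
  obtain ⟨E, hE⟩ := hm.exists_intermediateField hy0 hy1 huv hPu hQv hTuv hP hQ hT
  refine ⟨E, u, v, huv, Set.ext fun A => ?_⟩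
  rw [mem_subline_iff]
  constructor
  · intro hA
    by_cases hPA : P = A
    · exact .inl (hPA ▸ hPu)
    obtain ⟨c, hc⟩ := hm.exists_isCoord_smul_add hPu hQv hP hQ hA hPQ hPA
    exact .inr ⟨c, (hE c).2 ⟨A, hA, hc⟩, hc⟩
  · rintro (hA | ⟨c, hc, hA⟩)
    · exact hPu.unique hA ▸ hP
    · obtain ⟨B, hB, hBc⟩ := (hE c).1 hc
      exact hBc.unique hA ▸ hB

end IsSublineClosed

end SublineClosed

section Subfields

open IntermediateField Module

variable {F K : Type*} [Field F] [Field K] [Finite K] [Algebra F K]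

theorem le_of_finrank_dvd {E E' : IntermediateField F K} (h : finrank F E ∣ finrank F E') :
    E ≤ E' := by
  obtain ⟨f⟩ := FiniteField.nonempty_algHom_of_finrank_dvd h
  rw [← (E'.val.comp f).fieldRange_of_normal]
  rintro _ ⟨x, rfl⟩
  exact (f x).2

theorem le_total_of_isPrimePow (hn : IsPrimePow (finrank F K)) (E E' : IntermediateField F K) :
    E ≤ E' ∨ E' ≤ E := by
  obtain ⟨p, e, hp, -, he⟩ := hn
  have hd (L : IntermediateField F K) : finrank F L ∣ p ^ e :=
    he ▸ Dvd.intro _ (finrank_mul_finrank F L K)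
  obtain ⟨i, -, hi⟩ := (Nat.dvd_prime_pow hp.nat_prime).1 (hd E)
  obtain ⟨j, -, hj⟩ := (Nat.dvd_prime_pow hp.nat_prime).1 (hd E')
  rcases le_total i j with h | h
  · exact .inl (le_of_finrank_dvd (by rw [hi, hj]; exact pow_dvd_pow p h))
  · exact .inr (le_of_finrank_dvd (by rw [hi, hj]; exact pow_dvd_pow p h))

theorem le_adjoin_of_notMem (hn : IsPrimePow (finrank F K)) {E : IntermediateField F K} {θ : K}
    (hθ : θ ∉ E) : E ≤ F⟮θ⟯ :=
  (le_total_of_isPrimePow hn E F⟮θ⟯).resolve_right fun h => hθ (h (mem_adjoin_simple_self F θ))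

end Subfields

section Plane

open IntermediateField Module

theorem IsCoord.le_infinity {R : Type*} [Field R] {A : Type*} [AddCommGroup A] [Module R A]
    {P : ℙ R (A × A × R)} {v : A × A × R} (h : IsCoord P v) :
    P.submodule ≤ infinity R A ↔ v.2.2 = 0 :=
  h.submodule_le_iff

variable {F K : Type*} [Field F] [Field K] [Algebra F K]

/-- The parameter `η` of the point `(η • u + v)_K` at infinity of the line through `(u)_K` and
`(v)_K`, where `(u)_K` is an affine point. -/
def infParam (u v : K × K × K) : K := -(v.2.2 / u.2.2)

variable {E E' : IntermediateField F K} {u v : K × K × K}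

theorem smul_add_mem_infinity_iff (hu : u.2.2 ≠ 0) (c : K) :
    (c • u + v).2.2 = 0 ↔ c = infParam u v := by
  simp only [infParam, Prod.snd_add, Prod.smul_snd, smul_eq_mul]
  rw [add_eq_zero_iff_eq_neg, ← neg_div, eq_div_iff hu]

theorem exists_subline_eq_normalized (h : LinearIndependent K ![u, v]) (hu : u.2.2 ≠ 0) :
    ∃ u' v' : K × K × K, LinearIndependent K ![u', v'] ∧ u'.2.2 = 1 ∧
      infParam u' v' = infParam u v ∧ subline E u' v' = subline E u v := by
  have hc := inv_ne_zero hu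
  refine ⟨u.2.2⁻¹ • u, u.2.2⁻¹ • v, (LinearIndependent.pair_smul_iff hc).2 h, inv_mul_cancel₀ hu,
    ?_, subline_smul hc⟩
  simp only [infParam, Prod.smul_snd, smul_eq_mul, mul_div_mul_left _ _ hc]

theorem isExternal_subline_iff (h : LinearIndependent K ![u, v]) :
    IsExternal (subline E u v) ↔ u.2.2 ≠ 0 ∧ infParam u v ∉ E := by
  constructor
  · intro hext
    have hu : u.2.2 ≠ 0 := fun hu =>
      have hP : IsCoord _ u := isCoord_mk (R := K) (h.ne_zero 0)
      hext _ (mem_subline_iff.2 (.inl hP)) (hP.le_infinity.2 hu)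
    refine ⟨hu, fun hη => ?_⟩
    have hP := isCoord_mk (R := K) (smul_add_ne_zero_of_pair h (infParam u v))
    exact hext _ (mem_subline_iff.2 (.inr ⟨_, hη, hP⟩))
      (hP.le_infinity.2 ((smul_add_mem_infinity_iff hu _).2 rfl))
  · rintro ⟨hu, hη⟩ P hP hinf
    obtain hP | ⟨c, hc, hP⟩ := mem_subline_iff.1 hP
    · exact hu (hP.le_infinity.1 hinf)
    · exact hη ((smul_add_mem_infinity_iff hu c).1 (hP.le_infinity.1 hinf) ▸ hc)

theorem isTangent_subline_iff (h : LinearIndependent K ![u, v]) (hu : u.2.2 ≠ 0) :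
    IsTangent (subline E u v) ↔ infParam u v ∈ E := by
  have key {P : Plane K} (hP : P ∈ subline E u v) (hinf : P.submodule ≤ infinity K K) :
      infParam u v ∈ E ∧ IsCoord P (infParam u v • u + v) := by
    obtain hP | ⟨c, hc, hP⟩ := mem_subline_iff.1 hP
    · exact absurd (hP.le_infinity.1 hinf) hu
    · obtain rfl := (smul_add_mem_infinity_iff hu c).1 (hP.le_infinity.1 hinf)
      exact ⟨hc, hP⟩
  constructor
  · rintro ⟨P, ⟨hP, hinf⟩, -⟩
    exact (key hP hinf).1
  · intro hη
    have hP := isCoord_mk (R := K) (smul_add_ne_zero_of_pair h (infParam u v))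
    exact ⟨_, ⟨mem_subline_iff.2 (.inr ⟨_, hη, hP⟩),
      hP.le_infinity.2 ((smul_add_mem_infinity_iff hu _).2 rfl)⟩,
      fun Q hQ => (key hQ.1 hQ.2).2.unique hP⟩

theorem smallestTangentDegree_subline_iff [FiniteDimensional F K] (h : LinearIndependent K ![u, v])
    (hu : u.2.2 ≠ 0) {r : ℕ} : SmallestTangentDegree F K (subline E u v) r ↔
      finrank F ↥(E ⊔ F⟮infParam u v⟯) = r := by
  have hmin (j : ℕ) (m : Set (Plane K)) (hm : IsSubline F K j m) (ht : IsTangent m)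
      (hsub : subline E u v ⊆ m) : finrank F ↥(E ⊔ F⟮infParam u v⟯) ≤ j := by
    obtain ⟨L, u', v', rfl, h', rfl⟩ := hm
    change IsTangent (subline L u' v') at ht
    change _ ⊆ subline L u' v' at hsub
    have hL : subline L u' v' = subline L u v := subline_eq_of_subset h h' hsub
    rw [hL] at ht hsub
    rw [isTangent_subline_iff h hu, ← adjoin_simple_le_iff] at ht
    rw [subline_subset_subline_iff h] at hsub
    exact finrank_le_of_le_right (sup_le hsub ht)
  have htangent : IsTangent (subline (E ⊔ F⟮infParam u v⟯) u v) :=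
    (isTangent_subline_iff h hu).2 (le_sup_right (a := E) (mem_adjoin_simple_self F _))
  have hsub : subline E u v ⊆ subline (E ⊔ F⟮infParam u v⟯) u v := subline_mono le_sup_left
  constructor
  · rintro ⟨⟨m, hm, ht, hEm⟩, hle⟩
    exact (hmin r m hm ht hEm).antisymm (hle _ _ ⟨_, u, v, rfl, h, rfl⟩ htangent hsub)
  · rintro rfl
    exact ⟨⟨_, ⟨_, u, v, rfl, h, rfl⟩, htangent, hsub⟩, hmin⟩

theorem smallestTangentDegree_iff_finrank_adjoin [Finite K] (hn : IsPrimePow (finrank F K))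
    (h : LinearIndependent K ![u, v]) (hext : IsExternal (subline E u v)) {r : ℕ} :
    SmallestTangentDegree F K (subline E u v) r ↔ finrank F F⟮infParam u v⟯ = r := by
  obtain ⟨hu, hη⟩ := (isExternal_subline_iff h).1 hext
  rw [smallestTangentDegree_subline_iff h hu, sup_eq_right.2 (le_adjoin_of_notMem hn hη)]

theorem smallestTangentDegree_iff_of_subset [Finite K] (hn : IsPrimePow (finrank F K))
    {u' v' : K × K × K} (h : LinearIndependent K ![u, v]) (h' : LinearIndependent K ![u', v'])
    (hsub : subline E u v ⊆ subline E' u' v') (hext : IsExternal (subline E' u' v')) {r : ℕ} :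
    SmallestTangentDegree F K (subline E u v) r ↔
      SmallestTangentDegree F K (subline E' u' v') r := by
  rw [smallestTangentDegree_iff_finrank_adjoin hn h fun P hP => hext P (hsub hP)]
  rw [subline_eq_of_subset h h' hsub] at hext ⊢
  rw [smallestTangentDegree_iff_finrank_adjoin hn h hext]

end Plane

section ToPlane

theorem exists_isCoord_one {R : Type*} [Field R] {A : Type*} [AddCommGroup A] [Module R A]
    {P : ℙ R (A × A × R)} (hP : ¬ P.submodule ≤ infinity R A) :
    ∃ a b : A, IsCoord P (a, b, (1 : R)) := by
  obtain ⟨v, hv⟩ := exists_isCoord P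
  rw [hv.le_infinity] at hP
  refine ⟨v.2.2⁻¹ • v.1, v.2.2⁻¹ • v.2.1, ?_⟩
  convert hv.smul (inv_ne_zero hP) using 1
  ext <;> simp [hP]

variable (F K : Type*) [Field F] [Field K] [Algebra F K]

/-- The inclusion of the coordinate vectors of `PG(2n, q)` in those of `PG(2, q^n)`. -/
def inclVec : K × K × F →ₛₗ[algebraMap F K] K × K × K where
  toFun v := (v.1, v.2.1, algebraMap F K v.2.2)
  map_add' v w := by simp
  map_smul' c v := by simp [Algebra.smul_def]

theorem inclVec_injective : Function.Injective (inclVec F K) := by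
  rintro ⟨a, b, c⟩ ⟨a', b', c'⟩ h
  simpa [inclVec] using h

/-- The ABB-map read backwards: it inverts the ABB-map on affine points and sends a point at
infinity to the point whose spread element contains it. -/
def toPlane : Space F K → Plane K :=
  Projectivization.map (inclVec F K) (inclVec_injective F K)

variable {F K}

theorem IsCoord.toPlane {Q : Space F K} {v : K × K × F} (h : IsCoord Q v) :
    IsCoord (toPlane F K Q) (inclVec F K v) := by
  obtain ⟨hv, rfl⟩ := h
  exact isCoord_mk _

theorem toPlane_le_infinity_iff {Q : Space F K} :
    (toPlane F K Q).submodule ≤ infinity K K ↔ Q.submodule ≤ infinity F K := by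
  obtain ⟨v, hv⟩ := exists_isCoord Q
  rw [hv.le_infinity, hv.toPlane.le_infinity]
  exact map_eq_zero (algebraMap F K)

theorem toPlane_injOn : Set.InjOn (toPlane F K) {Q | ¬ Q.submodule ≤ infinity F K} := by
  intro Q hQ Q' hQ' h
  obtain ⟨a, b, hv⟩ := exists_isCoord_one hQ
  obtain ⟨a', b', hv'⟩ := exists_isCoord_one hQ'
  obtain ⟨c, -, hc⟩ := hv.toPlane.exists_smul (h ▸ hv'.toPlane)
  simp only [inclVec, LinearMap.coe_mk, AddHom.coe_mk, map_one, Prod.smul_mk, smul_eq_mul, mul_one,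
    Prod.mk.injEq] at hc
  obtain ⟨rfl, rfl, rfl⟩ := hc
  exact hv.unique (by simpa using hv')

theorem isCoord_toPlane_iff {Q : Space F K} {v : K × K × F} (hv : v.2.2 ≠ 0) :
    IsCoord (toPlane F K Q) (inclVec F K v) ↔ IsCoord Q v := by
  refine ⟨fun h => ?_, IsCoord.toPlane⟩
  have hP : IsCoord _ v := isCoord_mk (R := F) fun h0 => hv (by simp [h0])
  have hPinf := hP.le_infinity.not.2 hv
  have heq := h.unique hP.toPlane
  rwa [toPlane_injOn (toPlane_le_infinity_iff.not.1 (heq ▸ toPlane_le_infinity_iff.not.2 hPinf))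
    hPinf heq]

theorem exists_toPlane_eq {P : Plane K} (hP : ¬ P.submodule ≤ infinity K K) :
    ∃ Q, toPlane F K Q = P := by
  obtain ⟨a, b, hab⟩ := exists_isCoord_one hP
  have hQ : IsCoord _ (a, b, (1 : F)) := isCoord_mk (R := F) (by simp)
  exact ⟨_, hQ.toPlane.unique (by simpa [inclVec] using hab)⟩

theorem mem_abb_iff {P : Plane K} (hP : ¬ P.submodule ≤ infinity K K) {Q : Space F K} :
    Q ∈ abb F K P ↔ toPlane F K Q = P := by
  constructor
  · rintro (⟨a, b, hab, hQ⟩ | ⟨a, b, x, hab, -⟩)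
    · exact hQ.toPlane.unique (by simpa [inclVec] using hab)
    · exact absurd (hab.le_infinity.2 rfl) hP
  · rintro rfl
    rw [toPlane_le_infinity_iff] at hP
    obtain ⟨a, b, hab⟩ := exists_isCoord_one hP
    exact .inl ⟨a, b, by simpa [inclVec] using hab.toPlane, hab⟩

variable {m : Set (Plane K)}

theorem abbImage_eq_preimage (hm : IsExternal m) : abbImage F K m = toPlane F K ⁻¹' m := by
  ext Q
  simp only [abbImage, Set.mem_iUnion₂, Set.mem_preimage]
  constructor
  · rintro ⟨P, hP, hQ⟩
    exact ((mem_abb_iff (hm P hP)).1 hQ).symm ▸ hP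
  · exact fun hQ => ⟨_, hQ, (mem_abb_iff (hm _ hQ)).2 rfl⟩

theorem image_toPlane_abbImage (hm : IsExternal m) : toPlane F K '' abbImage F K m = m := by
  rw [abbImage_eq_preimage hm, Set.image_preimage_eq_of_subset]
  exact fun P hP => exists_toPlane_eq (hm P hP)

theorem not_le_infinity_of_mem_abbImage (hm : IsExternal m) {Q : Space F K}
    (hQ : Q ∈ abbImage F K m) : ¬ Q.submodule ≤ infinity F K := by
  rw [abbImage_eq_preimage hm] at hQ
  exact toPlane_le_infinity_iff.not.1 (hm _ hQ)

theorem isExternal_image_toPlane {M : Set (Space F K)}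
    (hM : ∀ P ∈ M, ¬ P.submodule ≤ infinity F K) : IsExternal (toPlane F K '' M) := by
  rintro _ ⟨Q, hQ, rfl⟩
  exact toPlane_le_infinity_iff.not.2 (hM Q hQ)

theorem abbImage_image_toPlane {M : Set (Space F K)}
    (hM : ∀ P ∈ M, ¬ P.submodule ≤ infinity F K) : abbImage F K (toPlane F K '' M) = M := by
  have hext := isExternal_image_toPlane hM
  rw [abbImage_eq_preimage hext]
  refine Set.Subset.antisymm ?_ (Set.subset_preimage_image _ _)
  rintro Q hQ
  obtain ⟨Q', hQ', h⟩ := id hQ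
  exact toPlane_injOn (hM Q' hQ') (toPlane_le_infinity_iff.not.1 (hext _ hQ)) h ▸ hQ'

theorem ncard_image_toPlane {M : Set (Space F K)}
    (hM : ∀ P ∈ M, ¬ P.submodule ≤ infinity F K) : (toPlane F K '' M).ncard = M.ncard :=
  (toPlane_injOn.mono hM).ncard_image

end ToPlane

section Span

variable {F K : Type*} [Field F] [Field K] [Algebra F K]

open IntermediateField Polynomial

theorem coeff_mem_of_eval_mem [Fintype F] {W : Submodule F K} {p : K[X]}
    (hp : p.natDegree < Fintype.card F) (h : ∀ c : F, p.eval (algebraMap F K c) ∈ W) (i : ℕ) :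
    p.coeff i ∈ W := by
  by_contra hi
  obtain ⟨φ, hφi, hφW⟩ := Submodule.exists_le_ker_of_notMem hi
  classical
  have hcoeff : ∀ j < Fintype.card F,
      (ofFn (Fintype.card F) fun j => φ (p.coeff j)).coeff j = φ (p.coeff j) :=
    fun j hj => ofFn_coeff_eq_val_of_lt _ hj
  have hdeg := ofFn_natDegree_lt Fintype.card_pos fun j : Fin (Fintype.card F) => φ (p.coeff j)
  have hzero := eq_zero_of_natDegree_lt_card_of_eval_eq_zero _ Function.injective_id
    (fun c => ?_) hdeg
  · rw [← hcoeff i (by_contra fun hlt => hφi ?_), hzero, coeff_zero] at hφi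
    · exact hφi rfl
    · rw [coeff_eq_zero_of_natDegree_lt (by lia), map_zero]
  · rw [← show φ (p.eval (algebraMap F K c)) = 0 from hφW (h c), eval_eq_sum_range' hdeg,
      eval_eq_sum_range' hp, map_sum]
    refine Finset.sum_congr rfl fun j hj => ?_
    rw [hcoeff j (Finset.mem_range.1 hj), ← map_pow, mul_comm (p.coeff j), ← Algebra.smul_def,
      map_smul, smul_eq_mul, mul_comm, id]

theorem adjoin_le_span_inv_sub [Fintype F] [FiniteDimensional F K] {η : K}
    (hη : η ∉ (⊥ : IntermediateField F K))
    (hcard : Module.finrank F F⟮η⟯ ≤ Fintype.card F) :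
    F⟮η⟯.toSubalgebra.toSubmodule ≤
      Submodule.span F (Set.range fun c : F => (algebraMap F K c - η)⁻¹) := by
  have hint : IsIntegral F η := .of_finite F η
  have hne : ∀ c : F, algebraMap F K c - η ≠ 0 := fun c h =>
    hη (IntermediateField.mem_bot.2 ⟨c, sub_eq_zero.1 h⟩)
  rw [adjoin_simple_toSubalgebra_of_isAlgebraic hint.isAlgebraic, ← span_coeff_minpolyDiv hint,
    Submodule.span_le]
  rintro _ ⟨i, rfl⟩
  refine coeff_mem_of_eval_mem ?_ (fun c => ?_) i
  · exact (natDegree_minpolyDiv_lt hint).trans_le (by rwa [← adjoin.finrank hint])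
  · have heval : (minpolyDiv F η).eval (algebraMap F K c) =
        (minpoly F η).eval c • (algebraMap F K c - η)⁻¹ := by
      rw [Algebra.smul_def, eq_mul_inv_iff_mul_eq₀ (hne c),
        ← aeval_algebraMap_apply_eq_algebraMap_eval, ← eval_map_algebraMap, ← minpolyDiv_spec]
      simp
    rw [heval]
    exact Submodule.smul_mem _ _ (Submodule.subset_span ⟨c, rfl⟩)

theorem mem_spanPts {V : Type*} [AddCommGroup V] [Module F V] {S : Set (ℙ F V)} {P : ℙ F V}
    {v : V} (hP : P ∈ S) (h : IsCoord P v) : v ∈ spanPts S :=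
  h.submodule_le_iff.1 (le_iSup₂_of_le P hP le_rfl)

theorem spreadMap_injective {a b : K} (h : (a, b) ≠ (0, 0)) :
    Function.Injective (spreadMap F K a b) := by
  refine (injective_iff_map_eq_zero _).2 fun x hx => by_contra fun hne => h ?_
  simpa [spreadMap, hne] using hx

theorem map_spreadMap_le_infinity (a b : K) (W : Submodule F K) :
    W.map (spreadMap F K a b) ≤ infinity F K := by
  rintro _ ⟨x, -, rfl⟩
  simp [infinity, spreadMap]

theorem span_singleton_inf_infinity (a b : K) :
    Submodule.span F {((a, b, 1) : K × K × F)} ⊓ infinity F K = ⊥ := by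
  rw [eq_bot_iff]
  rintro v ⟨hv, hv'⟩
  obtain ⟨c, rfl⟩ := Submodule.mem_span_singleton.1 hv
  have : c = 0 := by simpa [infinity] using hv'
  simp [this]

variable {E : IntermediateField F K} {u v : K × K × K}

/-- The spread element belonging to the point at infinity of the line through `u` and `v`,
parametrized by `x ↦ x • (infParam u v • u + v)`. -/
def spreadDir (u v : K × K × K) : K →ₗ[F] K × K × F :=
  spreadMap F K (infParam u v * u.1 + v.1) (infParam u v * u.2.1 + v.2.1)

theorem mem_abbImage_subline_iff (h : LinearIndependent K ![u, v]) (hu : u.2.2 = 1)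
    (hη : infParam u v ∉ E) {Q : Space F K} :
    Q ∈ abbImage F K (subline E u v) ↔ IsCoord Q (u.1, u.2.1, 1) ∨
      ∃ c ∈ E, IsCoord Q ((u.1, u.2.1, 1) + spreadDir u v (c - infParam u v)⁻¹) := by
  rw [abbImage_eq_preimage ((isExternal_subline_iff h).2 ⟨by simp [hu], hη⟩), Set.mem_preimage,
    mem_subline_iff]
  have hincl : inclVec F K (u.1, u.2.1, 1) = u := by ext <;> simp [inclVec, hu]
  have hpoint : ∀ c ∈ E, inclVec F K ((u.1, u.2.1, 1) + spreadDir u v (c - infParam u v)⁻¹) =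
      (c - infParam u v)⁻¹ • (c • u + v) := by
    intro c hc
    have hne : c - infParam u v ≠ 0 := fun h0 => hη (sub_eq_zero.1 h0 ▸ hc)
    have hv : v.2.2 = -infParam u v := by simp [infParam, hu]
    ext <;> simp [inclVec, spreadDir, spreadMap, hu, hv, ← sub_eq_add_neg] <;> field_simp <;>
      ring
  refine or_congr ?_ (exists_congr fun c => and_congr_right fun hc => ?_)
  · rw [← isCoord_toPlane_iff (F := F) (by simp), hincl]
  · rw [← isCoord_toPlane_iff (F := F) (by simp [spreadDir, spreadMap]), hpoint c hc,
      isCoord_smul_iff]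
    exact inv_ne_zero fun h0 => hη (sub_eq_zero.1 h0 ▸ hc)

variable [Fintype F] [FiniteDimensional F K]

theorem spanPts_abbImage_subline (h : LinearIndependent K ![u, v]) (hu : u.2.2 = 1)
    (hη : infParam u v ∉ E) (hE : E ≤ F⟮infParam u v⟯)
    (hcard : Module.finrank F F⟮infParam u v⟯ ≤ Fintype.card F) :
    spanPts (abbImage F K (subline E u v)) = Submodule.span F {((u.1, u.2.1, 1) : K × K × F)} ⊔
      F⟮infParam u v⟯.toSubalgebra.toSubmodule.map (spreadDir u v) := by
  set η := infParam u v
  have hpoint := @mem_abbImage_subline_iff F K _ _ _ E u v h hu hη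
  apply le_antisymm
  · refine iSup₂_le fun P hP => ?_
    obtain hP | ⟨c, hc, hP⟩ := hpoint.1 hP <;> rw [hP.submodule_le_iff]
    · exact Submodule.mem_sup_left (Submodule.mem_span_singleton_self _)
    · exact Submodule.add_mem_sup (Submodule.mem_span_singleton_self _) (Submodule.mem_map_of_mem
        (F⟮η⟯.inv_mem (sub_mem (hE hc) (mem_adjoin_simple_self F η))))
  · have ha : IsCoord _ (u.1, u.2.1, (1 : F)) := isCoord_mk (R := F) (by simp)
    have hmem := mem_spanPts (hpoint.2 (.inl ha)) ha
    refine sup_le ((Submodule.span_singleton_le_iff_mem _ _).2 hmem) ?_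
    refine (Submodule.map_mono (adjoin_le_span_inv_sub (fun hbot => hη (bot_le (a := E) hbot))
      hcard)).trans ?_
    rw [Submodule.map_span_le]
    rintro _ ⟨c, rfl⟩
    have hc : IsCoord _ ((u.1, u.2.1, (1 : F)) + spreadDir u v (algebraMap F K c - η)⁻¹) :=
      isCoord_mk (R := F) fun h0 => by simpa [spreadDir, spreadMap] using congrArg (·.2.2) h0
    exact (Submodule.add_mem_iff_right _ hmem).1
      (mem_spanPts (hpoint.2 (.inr ⟨_, E.algebraMap_mem c, hc⟩)) hc)

theorem spansOverSpread_abbImage_subline (h : LinearIndependent K ![u, v]) (hu : u.2.2 = 1)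
    (hext : IsExternal (subline E u v)) (hE : E ≤ F⟮infParam u v⟯)
    (hcard : Module.finrank F F⟮infParam u v⟯ ≤ Fintype.card F) :
    SpansOverSpread F K (Module.finrank F F⟮infParam u v⟯) (abbImage F K (subline E u v)) := by
  have hη := ((isExternal_subline_iff h).1 hext).2
  have hdir : (infParam u v * u.1 + v.1, infParam u v * u.2.1 + v.2.1) ≠ (0, 0) := by
    intro h0
    rw [Prod.mk.injEq] at h0
    exact smul_add_ne_zero_of_pair h (infParam u v)
      (Prod.ext h0.1 (Prod.ext h0.2 ((smul_add_mem_infinity_iff (by simp [hu]) _).2 rfl)))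
  have hle : F⟮infParam u v⟯.toSubalgebra.toSubmodule.map (spreadDir u v) ≤ infinity F K :=
    map_spreadMap_le_infinity _ _ _
  have hdisj := span_singleton_inf_infinity (F := F) u.1 u.2.1
  rw [SpansOverSpread, spanPts_abbImage_subline h hu hη hE hcard]
  refine ⟨?_, F⟮infParam u v⟯, _, _, rfl, hdir, ?_⟩
  · have hfin := Submodule.finrank_sup_add_finrank_inf_eq
      (Submodule.span F {((u.1, u.2.1, 1) : K × K × F)})
      (F⟮infParam u v⟯.toSubalgebra.toSubmodule.map (spreadDir u v))
    rw [eq_bot_iff.2 ((inf_le_inf_left _ hle).trans hdisj.le), finrank_bot, add_zero,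
      finrank_span_singleton (by simp), add_comm 1] at hfin
    rw [hfin]
    exact congrArg (· + 1)
      (Submodule.equivMapOfInjective _ (spreadMap_injective hdir) _).finrank_eq.symm
  · rw [sup_comm, sup_inf_assoc_of_le _ hle, hdisj, sup_bot_eq, spreadDir]

end Span

section Frobenius

variable (F K : Type*) [Field F] [Fintype F] [Field K] [Algebra F K]

/-- The `m`-th iterate `x ↦ x ^ q ^ m` of the Frobenius endomorphism. -/
def frobPow (m : ℕ) : K →ₐ[F] K := FiniteField.frobeniusAlgHom F K ^ m

variable {F K}

theorem frobPow_apply (m : ℕ) (x : K) : frobPow F K m x = x ^ Fintype.card F ^ m := by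
  rw [frobPow, AlgHom.coe_pow, FiniteField.coe_frobeniusAlgHom, pow_iterate]

theorem frobPow_add (m l : ℕ) (x : K) :
    frobPow F K (m + l) x = frobPow F K m (frobPow F K l x) := by
  rw [frobPow, pow_add]
  rfl

variable [Finite K]

theorem frobPow_surjective (m : ℕ) : Function.Surjective (frobPow F K m) :=
  Finite.surjective_of_injective (frobPow F K m).injective

theorem frobPow_eq_of_cast_eq {m l : ℕ} (h : (m : ZMod (Module.finrank F K)) = l) :
    frobPow F K m = frobPow F K l := by
  have h' := (ZMod.natCast_eq_natCast_iff' _ _ _).1 h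
  rw [← FiniteField.orderOf_frobeniusAlgHom] at h'
  rw [frobPow, frobPow, ← pow_mod_orderOf _ m, h', pow_mod_orderOf]

theorem frobPow_eq_self_iff (η : K) (m : ℕ) :
    frobPow F K m η = η ↔ (minpoly F η).natDegree ∣ m := by
  rw [(minpoly.irreducible (.of_finite F η)).natDegree_dvd_iff_dvd_X_pow_card_pow_sub_X,
    minpoly.dvd_iff, frobPow_apply, Nat.card_eq_fintype_card]
  simp [sub_eq_zero]

theorem exists_frobPow_of_aeval_minpoly_eq_zero {η x : K}
    (h : Polynomial.aeval x (minpoly F η) = 0) :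
    ∃ m < (minpoly F η).natDegree, frobPow F K m η = x := by
  have hint : IsIntegral F η := .of_finite F η
  obtain ⟨τ, rfl⟩ := minpoly.exists_algEquiv_of_root' hint.isAlgebraic h
  obtain ⟨i, hi⟩ := (FiniteField.bijective_frobeniusAlgHom_pow F K).2 (τ : K →ₐ[F] K)
  have hτ : frobPow F K i η = τ η := DFunLike.congr_fun hi η
  refine ⟨i % (minpoly F η).natDegree, Nat.mod_lt _ (minpoly.natDegree_pos hint), ?_⟩
  rw [← hτ, ← congrArg (frobPow F K · η) (Nat.mod_add_div (i : ℕ) (minpoly F η).natDegree)]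
  rw [frobPow_add, (frobPow_eq_self_iff η _).2 (dvd_mul_right _ _)]

end Frobenius

section ResidueSubspace

variable {F K : Type*} [Field F] [Field K] [Algebra F K]

variable (F K) in
/-- The subspace at infinity of the vectors supported on the indices congruent to `j` modulo `r`;
for `r ∣ n` it spans the member `Π^(σ^j)` of the indicator set of `D_r` over the large field. -/
def residueSubspace (r : ℕ) (j : ZMod r) : Submodule K (StarVec F K) where
  carrier := {v | v.2.2 = 0 ∧ ∀ i, (i.cast : ZMod r) ≠ j → v.1 i = 0 ∧ v.2.1 i = 0}
  add_mem' hv hw := ⟨by simp [hv.1, hw.1], fun i hi => by simp [hv.2 i hi, hw.2 i hi]⟩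
  zero_mem' := by simp
  smul_mem' c v hv := ⟨by simp [hv.1], fun i hi => by simp [hv.2 i hi]⟩

theorem eq_of_mem_residueSubspace {r : ℕ} {j j' : ZMod r} {v : StarVec F K} (hv : v ≠ 0)
    (h : v ∈ residueSubspace F K r j) (h' : v ∈ residueSubspace F K r j') : j = j' := by
  by_contra hne
  have hzero (i) : v.1 i = 0 ∧ v.2.1 i = 0 :=
    (eq_or_ne i.cast j).elim (fun hi => h'.2 i (hi ▸ hne)) (h.2 i)
  exact hv (Prod.ext (funext fun i => (hzero i).1) (Prod.ext (funext fun i => (hzero i).2) h.1))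

theorem single_mem_residueSubspace (r : ℕ) (j : ZMod (Module.finrank F K)) (a b : K) :
    ((Pi.single j a, Pi.single j b, 0) : StarVec F K) ∈ residueSubspace F K r j.cast := by
  refine ⟨rfl, fun i hi => ?_⟩
  have hij : i ≠ j := fun h => hi (by rw [h])
  simp [hij]

end ResidueSubspace

section Sigma

variable {F K : Type*} [Field F] [Fintype F] [Field K] [Algebra F K]

theorem IsCoord.sigma_iterate {P : StarSpace F K} {v : StarVec F K} (h : IsCoord P v) (m : ℕ) :
    IsCoord ((sigma F K)^[m] P) ((sigmaVec F K)^[m] v) := by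
  induction m with
  | zero => exact h
  | succ m ih =>
    rw [Function.iterate_succ_apply', Function.iterate_succ_apply']
    obtain ⟨hv, hP⟩ := ih
    rw [hP]
    exact ⟨(map_ne_zero_iff _ (sigmaVec_injective F K)).2 hv, Projectivization.map_mk ..⟩

theorem sigmaVec_iterate (m : ℕ) (v : StarVec F K) :
    (sigmaVec F K)^[m] v = (fun i => frobPow F K m (v.1 (i - m)),
      fun i => frobPow F K m (v.2.1 (i - m)), frobPow F K m v.2.2) := by
  induction m with
  | zero => simp [frobPow]
  | succ m ih =>
    rw [Function.iterate_succ_apply', ih]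
    simp only [sigmaVec, LinearMap.coe_mk, AddHom.coe_mk, frobPow_apply, ← pow_mul, ← pow_succ,
      sub_right_comm _ (1 : ZMod _), ← sub_sub, Nat.cast_succ]

theorem sigmaVec_iterate_single (a b : K) (m : ℕ) :
    (sigmaVec F K)^[m] (Pi.single 0 a, Pi.single 0 b, 0) =
      ((Pi.single (m : ZMod _) (frobPow F K m a), Pi.single (m : ZMod _) (frobPow F K m b), 0) :
        StarVec F K) := by
  rw [sigmaVec_iterate]
  ext i
  · by_cases hi : i = m <;> simp [sub_eq_zero, hi]
  · by_cases hi : i = m <;> simp [sub_eq_zero, hi]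
  · simp

theorem sigmaVec_emb [Finite K] (v : K × K × F) : sigmaVec F K (emb F K v) = emb F K v := by
  have : NeZero (Module.finrank F K) := ⟨Module.finrank_pos.ne'⟩
  have hstep (x : K) (i : ZMod (Module.finrank F K)) :
      frobPow F K 1 (frobPow F K (i - 1).val x) = frobPow F K i.val x := by
    rw [← frobPow_add]
    exact DFunLike.congr_fun (frobPow_eq_of_cast_eq (by simp)) x
  rw [← Function.iterate_one (sigmaVec F K), sigmaVec_iterate]
  simp only [emb, ← frobPow_apply, Nat.cast_one, hstep, AlgHom.commutes]

variable {r : ℕ}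

theorem sigmaVec_iterate_mem_residueSubspace (hr : r ∣ Module.finrank F K) {j : ZMod r}
    {v : StarVec F K} (h : v ∈ residueSubspace F K r j) (m : ℕ) :
    (sigmaVec F K)^[m] v ∈ residueSubspace F K r (j + m) := by
  rw [sigmaVec_iterate]
  refine ⟨by simp [h.1], fun i hi => ?_⟩
  have hi' : ((i - (m : ZMod (Module.finrank F K))).cast : ZMod r) ≠ j := by
    rwa [ZMod.cast_sub hr, ZMod.cast_natCast hr, Ne, sub_eq_iff_eq_add]
  simp [h.2 _ hi']

variable [Finite K]

theorem spanPts_iUnion_sigma_iterate_nu (hr : r ∣ Module.finrank F K) :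
    spanPts (⋃ j ∈ Set.Iio (Module.finrank F K / r), (sigma F K)^[r * j] '' nu F K) =
      residueSubspace F K r 0 := by
  have : NeZero (Module.finrank F K) := ⟨Module.finrank_pos.ne'⟩
  apply le_antisymm
  · refine iSup₂_le fun Q hQ => ?_
    simp only [Set.mem_iUnion₂] at hQ
    obtain ⟨j, -, Q, ⟨a, b, hQ⟩, rfl⟩ := hQ
    rw [(hQ.sigma_iterate _).submodule_le_iff]
    simpa using sigmaVec_iterate_mem_residueSubspace hr (single_mem_residueSubspace r 0 a b) (r * j)
  · intro v hv
    have hsum : v = ∑ i, (Pi.single i (v.1 i), Pi.single i (v.2.1 i), 0) := by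
      ext i <;> simp [Prod.fst_sum, Prod.snd_sum, Pi.single_apply, hv.1]
    rw [hsum]
    refine Submodule.sum_mem _ fun i _ => ?_
    by_cases hi : (i.cast : ZMod r) = 0
    · obtain ⟨l, hl⟩ : r ∣ i.val := (ZMod.natCast_eq_zero_iff _ _).1 (by rwa [ZMod.natCast_val])
      obtain ⟨a, ha⟩ := frobPow_surjective (F := F) (r * l) (v.1 i)
      obtain ⟨b, hb⟩ := frobPow_surjective (F := F) (r * l) (v.2.1 i)
      have hil : ((r * l : ℕ) : ZMod (Module.finrank F K)) = i := by
        rw [← hl, ZMod.natCast_val, ZMod.cast_id]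
      have hiter := sigmaVec_iterate_single (F := F) a b (r * l)
      rw [ha, hb, hil] at hiter
      rw [← hiter]
      obtain h0 | h0 := eq_or_ne ((Pi.single 0 a, Pi.single 0 b, 0) : StarVec F K) 0
      · simp [h0, iterate_map_zero]
      have hP := isCoord_mk (R := K) h0
      refine mem_spanPts ?_ (hP.sigma_iterate (r * l))
      have hlt : l < Module.finrank F K / r := by
        rw [Nat.lt_div_iff_mul_lt' hr, ← hl]
        exact ZMod.val_lt i
      exact Set.mem_biUnion hlt ⟨_, ⟨a, b, hP⟩, rfl⟩
    · simp [hv.2 i hi, ← Prod.zero_eq_mk]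

theorem mem_directorSpace_iff (hr : r ∣ Module.finrank F K) {P : StarSpace F K} :
    P ∈ directorSpace F K r ↔
      P.submodule ≤ residueSubspace F K r 0 ∧ (sigma F K)^[r] P = P := by
  rw [← spanPts_iUnion_sigma_iterate_nu hr]
  rfl

theorem exists_le_residueSubspace (hr : r ∣ Module.finrank F K) {P : StarSpace F K}
    (h : P ∈ indicatorPoints F K r) : ∃ i < r, P.submodule ≤ residueSubspace F K r i := by
  simp only [indicatorPoints, Set.mem_iUnion₂] at h
  obtain ⟨i, hi, Q, hQ, rfl⟩ := h
  obtain ⟨v, hv⟩ := exists_isCoord Q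
  have hQres := ((mem_directorSpace_iff hr).1 hQ).1
  rw [hv.submodule_le_iff] at hQres
  refine ⟨i, hi, (hv.sigma_iterate i).submodule_le_iff.2 ?_⟩
  simpa using sigmaVec_iterate_mem_residueSubspace hr hQres i

end Sigma

section RationalCurve

open Polynomial

variable {R : Type*} [Field R] {d : ℕ}

theorem mem_ratCurve_iff {V : Type*} [AddCommGroup V] [Module R V] {e : Fin (d + 1) → V}
    {P : ℙ R V} : P ∈ ratCurve e ↔
      IsCoord P (e 0) ∨ ∃ c : R, IsCoord P (∑ i : Fin (d + 1), c ^ (d - (i : ℕ)) • e i) := by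
  have hzero (s : R) :
      ∑ i : Fin (d + 1), (s ^ (d - (i : ℕ)) * 0 ^ (i : ℕ)) • e i = s ^ d • e 0 := by
    rw [Fin.sum_univ_succ]
    simp
  have hscale {s t : R} (ht : t ≠ 0) :
      ∑ i : Fin (d + 1), (s ^ (d - (i : ℕ)) * t ^ (i : ℕ)) • e i =
        t ^ d • ∑ i : Fin (d + 1), (s / t) ^ (d - (i : ℕ)) • e i := by
    rw [Finset.smul_sum]
    refine Finset.sum_congr rfl fun i _ => ?_
    have hd : t ^ d = t ^ (d - (i : ℕ)) * t ^ (i : ℕ) := by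
      rw [← pow_add, Nat.sub_add_cancel i.is_le]
    rw [smul_smul, div_pow, hd]
    field_simp
  constructor
  · rintro ⟨s, t, h⟩
    obtain rfl | ht := eq_or_ne t 0
    · rw [hzero] at h
      exact .inl ((isCoord_smul_iff fun h0 => h.ne_zero (by rw [h0, zero_smul])).1 h)
    · rw [hscale ht, isCoord_smul_iff (pow_ne_zero d ht)] at h
      exact .inr ⟨_, h⟩
  · rintro (h | ⟨c, h⟩)
    · exact ⟨1, 0, by rwa [hzero, one_pow, one_smul]⟩
    · exact ⟨c, 1, by simpa only [one_pow, mul_one] using h⟩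

theorem sum_pow_mul_map_coeff {S : Type*} [CommSemiring S] (φ : R →+* S) {p : R[X]}
    (hp : p.natDegree ≤ d) (c : S) :
    ∑ i : Fin (d + 1), c ^ (d - (i : ℕ)) * φ (p.coeff (d - i)) = p.eval₂ φ c := by
  rw [eval₂_eq_sum_range' φ (Nat.lt_succ_of_le hp), ← Finset.sum_range_reflect,
    ← Fin.sum_univ_eq_sum_range]
  simp only [Nat.succ_eq_add_one, Nat.add_sub_cancel, mul_comm]

theorem exists_polynomial_coeff_eq (e : Fin (d + 1) → R) :
    ∃ p : R[X], p.natDegree ≤ d ∧ ∀ i : Fin (d + 1), p.coeff (d - i) = e i := by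
  classical
  refine ⟨ofFn (d + 1) (e ∘ Fin.rev), Nat.le_of_lt_succ (ofFn_natDegree_lt (by omega) _),
    fun i => ?_⟩
  rw [ofFn_coeff_eq_val_of_lt _ (by omega), Function.comp_apply]
  congr 1
  ext
  simp only [Fin.val_rev]
  omega

end RationalCurve

section MinpolyDiv

open Polynomial IntermediateField Module

variable {F K : Type*} [Field F] [Field K] [Algebra F K]

theorem linearIndependent_coeff_minpolyDiv {η : K} (hη : IsIntegral F η) :
    LinearIndependent F fun i : Fin (minpoly F η).natDegree => (minpolyDiv F η).coeff i := by
  rw [linearIndependent_iff_card_eq_finrank_span, Fintype.card_fin]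
  have hspan : Submodule.span F (Set.range fun i : Fin (minpoly F η).natDegree =>
      (minpolyDiv F η).coeff i) = Subalgebra.toSubmodule F⟮η⟯.toSubalgebra := by
    rw [adjoin_simple_toSubalgebra_of_isAlgebraic hη.isAlgebraic, ← span_coeff_minpolyDiv hη]
    refine le_antisymm (Submodule.span_mono ?_) (Submodule.span_le.2 ?_)
    · rintro _ ⟨i, rfl⟩
      exact ⟨i, rfl⟩
    · rintro _ ⟨i, rfl⟩
      by_cases hi : i < (minpoly F η).natDegree
      · exact Submodule.subset_span ⟨⟨i, hi⟩, rfl⟩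
      · simp [coeff_eq_zero_of_natDegree_lt ((natDegree_minpolyDiv_lt hη).trans_le (not_lt.1 hi))]
  rw [Set.finrank, hspan]
  exact (adjoin.finrank hη).symm

variable [Finite K] {η : K}

theorem eval_minpolyDiv_self_ne_zero : eval η (minpolyDiv F η) ≠ 0 := by
  rw [eval_minpolyDiv_self]
  exact (Algebra.IsSeparable.isSeparable F η).aeval_derivative_ne_zero (minpoly.aeval F η)

variable [Fintype F]

theorem eval₂_frobPow_minpolyDiv {m : ℕ} (hm : ¬ (minpoly F η).natDegree ∣ m) :
    eval₂ (frobPow F K m : K →+* K) η (minpolyDiv F η) = 0 := by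
  classical
  have h := eval₂_minpolyDiv_self η (frobPow F K m) (AlgHom.id F K)
  rwa [AlgHom.id_apply, if_neg (by rwa [frobPow_eq_self_iff])] at h

theorem exists_eq_minpolyDiv_mul {A : K[X]} (hA : A.natDegree ≤ (minpoly F η).natDegree)
    (hroot : ∀ m < (minpoly F η).natDegree, m ≠ 0 → eval (frobPow F K m η) A = 0) :
    ∃ a b : K, A = minpolyDiv F η * (C a * X + C b) := by
  have hη : IsIntegral F η := .of_finite F η
  obtain rfl | hA0 := eq_or_ne A 0
  · exact ⟨0, 0, by simp⟩
  have hX : X - C η ≠ 0 := X_sub_C_ne_zero η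
  have hdvd : (minpoly F η).map (algebraMap F K) ∣ A * (X - C η) := by
    have hf0 := ((minpoly.monic hη).map (algebraMap F K)).ne_zero
    have hsep : ((minpoly F η).map (algebraMap F K)).Separable :=
      Polynomial.Separable.map (Algebra.IsSeparable.isSeparable F η)
    refine (IsGalois.splits F η).dvd_of_roots_le_roots hf0
      ((Multiset.le_iff_subset (nodup_roots hsep)).2 fun x hx => ?_)
    rw [mem_roots hf0, IsRoot, eval_map_algebraMap] at hx
    obtain ⟨m, hm, rfl⟩ := exists_frobPow_of_aeval_minpoly_eq_zero hx
    rw [mem_roots (mul_ne_zero hA0 hX), IsRoot, eval_mul]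
    obtain rfl | hm0 := eq_or_ne m 0
    · simp [frobPow]
    · rw [hroot m hm hm0, zero_mul]
  rw [← minpolyDiv_spec] at hdvd
  obtain ⟨t, rfl⟩ := (mul_dvd_mul_iff_right hX).1 hdvd
  have ht : t.natDegree ≤ 1 := by
    rw [(minpolyDiv_monic hη).natDegree_mul' (right_ne_zero_of_mul hA0)] at hA
    have := natDegree_minpolyDiv_succ hη
    omega
  obtain ⟨a, b, rfl⟩ := exists_eq_X_add_C_of_natDegree_le_one ht
  exact ⟨a, b, rfl⟩

end MinpolyDiv

section CurveVec

variable {F K : Type*} [Field F] [Fintype F] [Field K] [Algebra F K] {d : ℕ}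

/-- The coordinate vector of the point with parameter `(c, 1)`, `c ∈ K`, of the extension of
`ratCurve e` to `PG(2n, q^n)`. -/
def curveVec (e : Fin (d + 1) → K × K × F) (c : K) : StarVec F K :=
  ∑ i : Fin (d + 1), c ^ (d - (i : ℕ)) • emb F K (e i)

theorem curveVec_eq (e : Fin (d + 1) → K × K × F) (c : K) :
    curveVec e c =
      (fun j => ∑ i : Fin (d + 1), c ^ (d - (i : ℕ)) * frobPow F K j.val (e i).1,
        fun j => ∑ i : Fin (d + 1), c ^ (d - (i : ℕ)) * frobPow F K j.val (e i).2.1,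
        ∑ i : Fin (d + 1), c ^ (d - (i : ℕ)) * algebraMap F K (e i).2.2) := by
  ext <;> simp [curveVec, emb, frobPow_apply, Prod.fst_sum, Prod.snd_sum]

theorem mem_ratCurve_emb_iff {e : Fin (d + 1) → K × K × F} {P : StarSpace F K} :
    P ∈ ratCurve (fun i => emb F K (e i)) ↔
      IsCoord P (emb F K (e 0)) ∨ ∃ c, IsCoord P (curveVec e c) :=
  mem_ratCurve_iff

variable [Finite K]

theorem sigmaVec_iterate_curveVec (e : Fin (d + 1) → K × K × F) (c : K) (m : ℕ) :
    (sigmaVec F K)^[m] (curveVec e c) = curveVec e (frobPow F K m c) := by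
  induction m with
  | zero => simp [frobPow]
  | succ m ih =>
    rw [Function.iterate_succ_apply', ih, add_comm, frobPow_add, curveVec, curveVec, map_sum]
    refine Finset.sum_congr rfl fun i _ => ?_
    have hone : frobPow F K 1 = FiniteField.frobeniusAlgHom F K := pow_one _
    rw [LinearMap.map_smulₛₗ, sigmaVec_emb, map_pow, hone]
    rfl

theorem IsCoord.sigma_iterate_curveVec {e : Fin (d + 1) → K × K × F} {c : K} {P : StarSpace F K}
    (h : IsCoord P (curveVec e c)) (m : ℕ) :
    IsCoord ((sigma F K)^[m] P) (curveVec e (frobPow F K m c)) := by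
  rw [← sigmaVec_iterate_curveVec]
  exact h.sigma_iterate m

end CurveVec

section CurveFrame

open Polynomial IntermediateField Module

variable {F K : Type*} [Field F] [Field K] [Algebra F K] {r : ℕ}
  {e : Fin (r + 1) → K × K × F} {u v : K × K × K}

/-- With `η` the parameter of the point at infinity of the line through `(u)_K` and `(v)_K`, and
`f` its minimal polynomial over `F`, of degree `r`: the vectors `e_0, …, e_r` are the coefficients
of `X^r, …, X^0` in `(f / (X - η)) (X u + v)`. -/
def IsCurveFrame (e : Fin (r + 1) → K × K × F) (u v : K × K × K) : Prop :=
  (minpoly F (infParam u v)).natDegree = r ∧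
    ∀ i : Fin (r + 1), inclVec F K (e i) =
      (X * minpolyDiv F (infParam u v)).coeff (r - i) • u +
        (minpolyDiv F (infParam u v)).coeff (r - i) • v

theorem algebraMap_coeff_minpoly (η : K) (i : ℕ) :
    algebraMap F K ((minpoly F η).coeff i) =
      (X * minpolyDiv F η).coeff i - η * (minpolyDiv F η).coeff i := by
  rw [← coeff_map, ← minpolyDiv_spec, mul_comm, sub_mul, coeff_sub, coeff_C_mul]

theorem eq_neg_infParam_mul (hu : u.2.2 ≠ 0) : v.2.2 = -infParam u v * u.2.2 := by
  rw [infParam]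
  field_simp

theorem eval_minpolyDiv_mul (hu : u.2.2 ≠ 0) (c : K) :
    (minpolyDiv F (infParam u v)).eval c * (c * u.2.2 + v.2.2) =
      u.2.2 * aeval c (minpoly F (infParam u v)) := by
  rw [← eval_map_algebraMap, ← minpolyDiv_spec, eq_neg_infParam_mul (v := v) hu]
  simp only [eval_mul, eval_sub, eval_X, eval_C]
  ring

theorem sum_pow_mul_map_combination {S : Type*} [CommSemiring S] (φ : K →+* S) {p : K[X]}
    (hp : p.natDegree < r) (a b : K) (c : S) :
    ∑ i : Fin (r + 1), c ^ (r - (i : ℕ)) * φ ((X * p).coeff (r - i) * a + p.coeff (r - i) * b) =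
      p.eval₂ φ c * (c * φ a + φ b) := by
  have hXp : (X * p).natDegree ≤ r := natDegree_mul_le.trans (by rw [natDegree_X]; omega)
  simp only [map_add, map_mul, mul_add, ← mul_assoc, Finset.sum_add_distrib, ← Finset.sum_mul,
    sum_pow_mul_map_coeff φ hXp, sum_pow_mul_map_coeff φ hp.le, eval₂_mul, eval₂_X]
  ring

namespace IsCurveFrame

variable (h : IsCurveFrame e u v)
include h

theorem fst (i : Fin (r + 1)) :
    (e i).1 = (X * minpolyDiv F (infParam u v)).coeff (r - i) * u.1 +
      (minpolyDiv F (infParam u v)).coeff (r - i) * v.1 :=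
  congrArg Prod.fst (h.2 i)

theorem snd (i : Fin (r + 1)) :
    (e i).2.1 = (X * minpolyDiv F (infParam u v)).coeff (r - i) * u.2.1 +
      (minpolyDiv F (infParam u v)).coeff (r - i) * v.2.1 :=
  congrArg (fun w : K × K × K => w.2.1) (h.2 i)

theorem thd (i : Fin (r + 1)) :
    algebraMap F K (e i).2.2 = (X * minpolyDiv F (infParam u v)).coeff (r - i) * u.2.2 +
      (minpolyDiv F (infParam u v)).coeff (r - i) * v.2.2 :=
  congrArg (fun w : K × K × K => w.2.2) (h.2 i)

variable [Finite K]

theorem natDegree_minpolyDiv_lt : (minpolyDiv F (infParam u v)).natDegree < r :=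
  (_root_.natDegree_minpolyDiv_lt (.of_finite F (infParam u v))).trans_eq h.1

theorem inclVec_sum (c : F) :
    inclVec F K (∑ i : Fin (r + 1), c ^ (r - (i : ℕ)) • e i) =
      (minpolyDiv F (infParam u v)).eval (algebraMap F K c) • (algebraMap F K c • u + v) := by
  have key (a b : K) := sum_pow_mul_map_combination (RingHom.id K) h.natDegree_minpolyDiv_lt a b
    (algebraMap F K c)
  simp only [RingHom.id_apply, eval₂_id] at key
  ext <;> simp [inclVec, Prod.fst_sum, Prod.snd_sum, h.fst, h.snd, h.thd, key, Algebra.smul_def]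

theorem inclVec_zero : inclVec F K (e 0) = u := by
  have hint : IsIntegral F (infParam u v) := .of_finite F _
  have hr := natDegree_minpolyDiv_succ hint
  rw [h.1] at hr
  have hmonic : (minpolyDiv F (infParam u v)).coeff (minpolyDiv F (infParam u v)).natDegree = 1 :=
    minpolyDiv_monic hint
  rw [h.2 0, Fin.val_zero, Nat.sub_zero, coeff_eq_zero_of_natDegree_lt h.natDegree_minpolyDiv_lt,
    ← hr, coeff_X_mul, hmonic, one_smul, zero_smul, add_zero]

theorem ratCurve_eq (hu : u.2.2 ≠ 0) (hη : infParam u v ∉ (⊥ : IntermediateField F K)) :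
    ratCurve e = toPlane F K ⁻¹' subline (⊥ : IntermediateField F K) u v := by
  have hroot (c : F) : aeval (algebraMap F K c) (minpoly F (infParam u v)) ≠ 0 := by
    rw [aeval_algebraMap_apply_eq_algebraMap_eval, _root_.map_ne_zero]
    intro h0
    have hdeg := degree_eq_one_of_irreducible_of_root
      (minpoly.irreducible (.of_finite F (infParam u v))) h0
    exact hη (mem_bot.2 (minpoly.degree_eq_one_iff.1 hdeg))
  have hne (c : F) := (eval_minpolyDiv_mul (F := F) hu (algebraMap F K c)).trans_ne
    (mul_ne_zero hu (hroot c))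
  have hthird (c : F) : algebraMap F K (∑ i : Fin (r + 1), c ^ (r - (i : ℕ)) • e i).2.2 ≠ 0 :=
    (congrArg (·.2.2) (h.inclVec_sum c)).trans_ne (hne c)
  have hzero : algebraMap F K (e 0).2.2 ≠ 0 := (congrArg (·.2.2) h.inclVec_zero).trans_ne hu
  ext P
  rw [mem_ratCurve_iff, Set.mem_preimage, mem_subline_iff]
  refine or_congr ?_ ?_
  · rw [← isCoord_toPlane_iff (K := K) ((_root_.map_ne_zero _).1 hzero), h.inclVec_zero]
  · simp only [mem_bot, Set.exists_range_iff]
    refine exists_congr fun c => ?_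
    rw [← isCoord_toPlane_iff (K := K) ((_root_.map_ne_zero _).1 (hthird c)), h.inclVec_sum,
      isCoord_smul_iff (left_ne_zero_of_mul (hne c))]

variable [Fintype F]

theorem curveVec_eq (c : K) :
    curveVec e c =
      (fun j => (minpolyDiv F (infParam u v)).eval₂ (frobPow F K j.val : K →+* K) c *
          (c * frobPow F K j.val u.1 + frobPow F K j.val v.1),
        fun j => (minpolyDiv F (infParam u v)).eval₂ (frobPow F K j.val : K →+* K) c *
          (c * frobPow F K j.val u.2.1 + frobPow F K j.val v.2.1),
        (minpolyDiv F (infParam u v)).eval c * (c * u.2.2 + v.2.2)) := by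
  have key (φ : K →+* K) (a b : K) :=
    sum_pow_mul_map_combination φ h.natDegree_minpolyDiv_lt a b c
  rw [ABB.curveVec_eq]
  simp only [h.fst, h.snd, h.thd]
  refine Prod.ext (funext fun j => key (frobPow F K j.val) _ _)
    (Prod.ext (funext fun j => key (frobPow F K j.val) _ _) (key (.id K) _ _))

end IsCurveFrame

end CurveFrame

section SpecialCurve

open Polynomial IntermediateField Module

variable {F K : Type*} [Field F] [Field K] [Algebra F K] {r : ℕ}
  {e : Fin (r + 1) → K × K × F} {u v : K × K × K}

theorem exists_isCurveFrame (hu : u.2.2 = 1) (hr : (minpoly F (infParam u v)).natDegree = r) :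
    ∃ e : Fin (r + 1) → K × K × F, IsCurveFrame e u v := by
  set g := minpolyDiv F (infParam u v)
  refine ⟨fun i => ((X * g).coeff (r - i) * u.1 + g.coeff (r - i) * v.1,
    (X * g).coeff (r - i) * u.2.1 + g.coeff (r - i) * v.2.1,
    (minpoly F (infParam u v)).coeff (r - i)), hr, fun i => ?_⟩
  have hv : v.2.2 = -infParam u v := by
    rw [eq_neg_infParam_mul (hu.trans_ne one_ne_zero), hu, mul_one]
  refine Prod.ext rfl (Prod.ext rfl ?_)
  simp only [inclVec, LinearMap.coe_mk, AddHom.coe_mk, algebraMap_coeff_minpoly, Prod.snd_add,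
    Prod.smul_snd, smul_eq_mul, hu, hv]
  ring

namespace IsCurveFrame

variable [Finite K] (h : IsCurveFrame e u v)
include h

theorem linearIndependent (huv : LinearIndependent K ![u, v]) : LinearIndependent F e := by
  obtain rfl := h.1
  have hint : IsIntegral F (infParam u v) := .of_finite F _
  rw [Fintype.linearIndependent_iff]
  intro a ha
  have hsum := congrArg (inclVec F K) ha
  simp only [map_sum, LinearMap.map_smulₛₗ, h.2, smul_add, smul_smul, Finset.sum_add_distrib,
    ← Finset.sum_smul, map_zero] at hsum
  have hv := (LinearIndependent.pair_iff.1 huv _ _ hsum).2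
  rw [Fin.sum_univ_succ, Fin.val_zero, Nat.sub_zero,
    coeff_eq_zero_of_natDegree_lt h.natDegree_minpolyDiv_lt, mul_zero, zero_add] at hv
  have htail : ∀ i : Fin (minpoly F (infParam u v)).natDegree, a i.succ = 0 := by
    refine Fintype.linearIndependent_iff.1
      ((linearIndependent_coeff_minpolyDiv hint).comp Fin.rev Fin.rev_injective) _ ?_
    simpa only [Function.comp_apply, Fin.val_rev, Algebra.smul_def, Fin.val_succ] using hv
  have hhead : a 0 = 0 := by
    have he0 : e 0 ≠ 0 := fun h0 => huv.ne_zero 0 (by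
      rw [Matrix.cons_val_zero, ← h.inclVec_zero, h0, map_zero])
    simpa [Fin.sum_univ_succ, htail, he0] using ha
  exact Fin.cases hhead htail

theorem linearIndependent_pair (hu : u.2.2 ≠ 0) (he : LinearIndependent F e) :
    LinearIndependent K ![u, v] := by
  rw [LinearIndependent.pair_iff' fun hu0 => hu (by simp [hu0])]
  intro a hv
  have ha : infParam u v = -a := by
    rw [infParam, ← hv, Prod.smul_snd, Prod.smul_snd, smul_eq_mul, mul_div_cancel_right₀ _ hu]
  have hprop (i : Fin (r + 1)) : e i = (minpoly F (infParam u v)).coeff (r - i) • e 0 := by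
    apply inclVec_injective F K
    rw [LinearMap.map_smulₛₗ, h.inclVec_zero, algebraMap_coeff_minpoly, h.2 i, ha, ← hv]
    module
  have hr : 0 < r := h.1 ▸ minpoly.natDegree_pos (.of_finite F (infParam u v))
  have hpair : LinearIndependent F ![e 0, e (Fin.last r)] := by
    convert he.comp ![0, Fin.last r] _ using 1
    · ext i : 1
      fin_cases i <;> rfl
    · intro i j hij
      fin_cases i <;> fin_cases j <;> simp_all [Fin.ext_iff]
  exact (LinearIndependent.pair_iff' (he.ne_zero 0)).1 hpair _ (hprop (Fin.last r)).symm

variable [Fintype F]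

theorem curveVec_infParam_mem_residueSubspace (hu : u.2.2 ≠ 0) :
    curveVec e (infParam u v) ∈ residueSubspace F K r 0 := by
  have : NeZero (finrank F K) := ⟨finrank_pos.ne'⟩
  rw [h.curveVec_eq]
  refine ⟨?_, fun i hi => ?_⟩
  · rw [eval_minpolyDiv_mul hu, minpoly.aeval, mul_zero]
  · rw [← ZMod.natCast_val, Ne, ZMod.natCast_eq_zero_iff, ← h.1] at hi
    simp only [eval₂_frobPow_minpolyDiv hi, zero_mul, and_self]

theorem curveVec_infParam_ne_zero (huv : LinearIndependent K ![u, v]) (hu : u.2.2 ≠ 0) :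
    curveVec e (infParam u v) ≠ 0 := by
  intro h0
  rw [h.curveVec_eq] at h0
  have hfrob (x : K) : frobPow F K (0 : ZMod (finrank F K)).val x = x := by
    rw [ZMod.val_zero, frobPow, pow_zero, AlgHom.one_apply]
  have hid : (frobPow F K (0 : ZMod (finrank F K)).val : K →+* K) = .id K := RingHom.ext hfrob
  have hg : (minpolyDiv F (infParam u v)).eval₂ (.id K) (infParam u v) ≠ 0 :=
    eval_minpolyDiv_self_ne_zero
  have hfst := congrFun (congrArg Prod.fst h0) 0
  have hsnd := congrFun (congrArg (·.2.1) h0) 0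
  have hthd : infParam u v * u.2.2 + v.2.2 = 0 := by
    rw [eq_neg_infParam_mul (v := v) hu]
    ring
  simp only [hid, hfrob] at hfst hsnd
  exact smul_add_ne_zero_of_pair huv (infParam u v) (Prod.ext ((mul_eq_zero_iff_left hg).1 hfst)
    (Prod.ext ((mul_eq_zero_iff_left hg).1 hsnd) hthd))

end IsCurveFrame

variable [Fintype F]

theorem injOn_sigma_iterate (hr : r ∣ finrank F K) {Q : StarSpace F K} {w : StarVec F K}
    (hQ : IsCoord Q w) (hw : w ∈ residueSubspace F K r 0) :
    Set.InjOn (fun m : ℕ => (sigma F K)^[m] Q) (Set.Iio r) := by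
  intro l hl l' hl' hll
  have hres (m : ℕ) := sigmaVec_iterate_mem_residueSubspace hr hw m
  have hl₁ := (hQ.sigma_iterate l).submodule_le_iff.2 (hres l)
  rw [show (sigma F K)^[l] Q = (sigma F K)^[l'] Q from hll,
    (hQ.sigma_iterate l').submodule_le_iff] at hl₁
  have hcast := eq_of_mem_residueSubspace (hQ.sigma_iterate l').ne_zero hl₁ (hres l')
  rw [zero_add, zero_add, ZMod.natCast_eq_natCast_iff] at hcast
  exact hcast.eq_of_lt_of_lt hl hl'

variable [Finite K]

theorem IsCurveFrame.meetsIndicator (h : IsCurveFrame e u v) (huv : LinearIndependent K ![u, v])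
    (hu : u.2.2 ≠ 0) (hr : r ∣ finrank F K) :
    MeetsIndicator F K r (ratCurve (fun i => emb F K (e i))) := by
  have hres := h.curveVec_infParam_mem_residueSubspace hu
  obtain ⟨Q, hQ⟩ : ∃ Q, IsCoord Q (curveVec e (infParam u v)) :=
    ⟨_, isCoord_mk (R := K) (h.curveVec_infParam_ne_zero huv hu)⟩
  have hQm (m : ℕ) := hQ.sigma_iterate_curveVec m
  have hdir : Q ∈ directorSpace F K r := by
    refine (mem_directorSpace_iff hr).2 ⟨hQ.submodule_le_iff.2 hres, ?_⟩
    have hfix := hQm r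
    rw [(frobPow_eq_self_iff _ r).2 h.1.dvd] at hfix
    exact hfix.unique hQ
  refine ⟨Q, injOn_sigma_iterate hr hQ hres, Set.Subset.antisymm ?_ ?_⟩
  · rintro P ⟨hP, hPi⟩
    obtain ⟨i, -, hi⟩ := exists_le_residueSubspace hr hPi
    obtain hP | ⟨c, hP⟩ := mem_ratCurve_emb_iff.1 hP
    · have h0 := (hP.submodule_le_iff.1 hi).1
      exact absurd ((congrArg (·.2.2) h.inclVec_zero).symm.trans h0) hu
    · have h0 := (hP.submodule_le_iff.1 hi).1
      rw [h.curveVec_eq, eval_minpolyDiv_mul hu] at h0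
      obtain ⟨m, hm, rfl⟩ :=
        exists_frobPow_of_aeval_minpoly_eq_zero ((mul_eq_zero_iff_left hu).1 h0)
      exact ⟨m, hm.trans_eq h.1, (hQm m).unique hP⟩
  · rintro _ ⟨m, hm, rfl⟩
    exact ⟨mem_ratCurve_emb_iff.2 (.inr ⟨_, hQm m⟩), Set.mem_biUnion hm ⟨Q, hdir, rfl⟩⟩

end SpecialCurve

section FrameOfMeetsIndicator

open Polynomial IntermediateField Module

variable {F K : Type*} [Field F] [Field K] [Finite K] [Algebra F K] {r : ℕ}
  {e : Fin (r + 1) → K × K × F}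

theorem exists_eq_mul_coeff_minpoly {η : K} (hdvd : r ∣ (minpoly F η).natDegree)
    {c : Fin (r + 1) → F} (hc : c ≠ 0)
    (hη : ∑ i : Fin (r + 1), η ^ (r - (i : ℕ)) * algebraMap F K (c i) = 0) :
    (minpoly F η).natDegree = r ∧
      ∃ δ : F, δ ≠ 0 ∧ ∀ i, c i = δ * (minpoly F η).coeff (r - i) := by
  have hint : IsIntegral F η := .of_finite F η
  obtain ⟨D, hD, hDc⟩ := exists_polynomial_coeff_eq c
  simp only [← hDc, sum_pow_mul_map_coeff (algebraMap F K) hD] at hη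
  have hD0 : D ≠ 0 := fun h0 => hc (funext fun i => by rw [← hDc i, h0, coeff_zero, Pi.zero_apply])
  have hfD : minpoly F η ∣ D := minpoly.dvd F η hη
  have hdeg : (minpoly F η).natDegree = r :=
    le_antisymm ((natDegree_le_of_dvd hfD hD0).trans hD)
      (Nat.le_of_dvd (minpoly.natDegree_pos hint) hdvd)
  refine ⟨hdeg, D.leadingCoeff, leadingCoeff_ne_zero.2 hD0, fun i => ?_⟩
  rw [← hDc, ← coeff_C_mul, ← eq_leadingCoeff_mul_of_monic_of_dvd_of_natDegree_le
    (minpoly.monic hint) hfD (hD.trans_eq hdeg.symm)]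

variable [Fintype F]

theorem exists_curveVec_mem_residueSubspace (hr : r ∣ finrank F K) (hr2 : 2 ≤ r)
    (h : MeetsIndicator F K r (ratCurve fun i => emb F K (e i))) :
    ∃ η : K, ∀ m : ℕ, curveVec e (frobPow F K m η) ≠ 0 ∧
      curveVec e (frobPow F K m η) ∈ residueSubspace F K r m := by
  obtain ⟨Q, hinj, hset⟩ := h
  obtain ⟨hQC, hQi⟩ := hset.ge ⟨0, zero_lt_two.trans_le hr2, rfl⟩
  obtain ⟨i, hir, hi⟩ := exists_le_residueSubspace hr hQi
  obtain hQ | ⟨c, hQ⟩ := mem_ratCurve_emb_iff.1 hQC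
  · have hfix := hQ.sigma_iterate 1
    rw [Function.iterate_one (sigmaVec F K), sigmaVec_emb] at hfix
    have h01 := hinj (zero_lt_two.trans_le hr2) (one_lt_two.trans_le hr2) (hQ.unique hfix)
    exact absurd h01 zero_ne_one
  · refine ⟨frobPow F K (r - i) c, fun m => ?_⟩
    rw [← frobPow_add]
    refine ⟨(hQ.sigma_iterate_curveVec _).ne_zero, ?_⟩
    rw [← sigmaVec_iterate_curveVec]
    have hmem := sigmaVec_iterate_mem_residueSubspace hr (hQ.submodule_le_iff.1 hi) (m + (r - i))
    rwa [← Nat.cast_add, add_left_comm, Nat.add_sub_cancel' hir.le, Nat.cast_add,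
      ZMod.natCast_self, add_zero] at hmem

theorem dvd_natDegree_minpoly {η : K} (h : ∀ m : ℕ, curveVec e (frobPow F K m η) ≠ 0 ∧
    curveVec e (frobPow F K m η) ∈ residueSubspace F K r m) : r ∣ (minpoly F η).natDegree := by
  have hzero := (h 0).2
  have hd := h (minpoly F η).natDegree
  rw [(frobPow_eq_self_iff η 0).2 (dvd_zero _)] at hzero
  rw [(frobPow_eq_self_iff η _).2 dvd_rfl] at hd
  have hcast := eq_of_mem_residueSubspace hd.1 hd.2 hzero
  rwa [Nat.cast_zero, ZMod.natCast_eq_zero_iff] at hcast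

theorem exists_eq_coeff_minpolyDiv {η : K} (hdeg : (minpoly F η).natDegree = r)
    {a : Fin (r + 1) → K}
    (h : ∀ m < r, m ≠ 0 → ∑ i : Fin (r + 1), frobPow F K m η ^ (r - (i : ℕ)) * a i = 0) :
    ∃ x y : K, ∀ i : Fin (r + 1),
      a i = (X * minpolyDiv F η).coeff (r - i) * x + (minpolyDiv F η).coeff (r - i) * y := by
  obtain ⟨A, hA, hAa⟩ := exists_polynomial_coeff_eq a
  have hroot : ∀ m < (minpoly F η).natDegree, m ≠ 0 → eval (frobPow F K m η) A = 0 := by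
    intro m hm hm0
    rw [← h m (hm.trans_eq hdeg) hm0, ← eval₂_id, ← sum_pow_mul_map_coeff (.id K) hA]
    simp only [RingHom.id_apply, hAa]
  obtain ⟨x, y, rfl⟩ := exists_eq_minpolyDiv_mul (hA.trans_eq hdeg.symm) hroot
  refine ⟨x, y, fun i => ?_⟩
  rw [← hAa, ← coeff_mul_C, ← coeff_mul_C, ← coeff_add]
  congr 1
  ring

theorem exists_isCurveFrame_of_meetsIndicator (hr : r ∣ finrank F K) (hr2 : 2 ≤ r)
    (he : (fun i => (e i).2.2) ≠ 0) (h : MeetsIndicator F K r (ratCurve fun i => emb F K (e i))) :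
    ∃ u v : K × K × K, u.2.2 ≠ 0 ∧ IsCurveFrame e u v := by
  obtain ⟨η, hη⟩ := exists_curveVec_mem_residueSubspace hr hr2 h
  have hdvd := dvd_natDegree_minpoly hη
  simp only [curveVec_eq] at hη
  have hthd := (hη 0).2.1
  rw [(frobPow_eq_self_iff η 0).2 (dvd_zero _)] at hthd
  obtain ⟨hdeg, δ, hδ, hc⟩ := exists_eq_mul_coeff_minpoly hdvd he hthd
  have hvanish (m : ℕ) (hm : m < r) (hm0 : m ≠ 0) := (hη m).2.2 0 (by
    rw [ZMod.cast_zero, ne_comm, Ne, ZMod.natCast_eq_zero_iff]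
    exact Nat.not_dvd_of_pos_of_lt (Nat.pos_of_ne_zero hm0) hm)
  simp only [ZMod.val_zero, frobPow, pow_zero, AlgHom.one_apply] at hvanish
  obtain ⟨a, a', ha⟩ := exists_eq_coeff_minpolyDiv hdeg fun m hm hm0 => (hvanish m hm hm0).1
  obtain ⟨b, b', hb⟩ := exists_eq_coeff_minpolyDiv hdeg fun m hm hm0 => (hvanish m hm hm0).2
  have hδ' : algebraMap F K δ ≠ 0 := (_root_.map_ne_zero _).2 hδ
  have hparam : infParam (a, b, algebraMap F K δ) (a', b', -(algebraMap F K δ * η)) = η := by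
    rw [infParam, neg_div, neg_neg, mul_div_cancel_left₀ _ hδ']
  refine ⟨(a, b, algebraMap F K δ), (a', b', -(algebraMap F K δ * η)), hδ', ?_⟩
  rw [IsCurveFrame, hparam]
  refine ⟨hdeg, fun i => Prod.ext (ha i) (Prod.ext (hb i) ?_)⟩
  have hci := congrArg (algebraMap F K) (hc i)
  rw [map_mul, algebraMap_coeff_minpoly] at hci
  refine hci.trans ?_
  simp only [Prod.snd_add, Prod.smul_snd, smul_eq_mul]
  ring

end FrameOfMeetsIndicator

section ExternalSublineImage

open IntermediateField Module

variable {F K : Type*} [Field F] [Field K] [Algebra F K] {k r : ℕ}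
  {M : Set (Space F K)}

variable (F K) in
/-- `M` is the image under the ABB-map of an `𝔽_{q^k}`-subline external to `l_∞` for which the
smallest tangent subline containing it is an `𝔽_{q^r}`-subline. -/
def IsExternalSublineImage (k r : ℕ) (M : Set (Space F K)) : Prop :=
  ∃ m, IsSubline F K k m ∧ IsExternal m ∧ SmallestTangentDegree F K m r ∧ M = abbImage F K m

theorem exists_mem_ratCurve_le_infinity {e : Fin 2 → K × K × F} (he : LinearIndependent F e) :
    ∃ P ∈ ratCurve e, P.submodule ≤ infinity F K := by
  by_cases h0 : (e 0).2.2 = 0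
  · have hP : IsCoord _ (e 0) := isCoord_mk (R := F) (he.ne_zero 0)
    exact ⟨_, mem_ratCurve_iff.2 (.inl hP), hP.le_infinity.2 h0⟩
  · have hpair : LinearIndependent F ![e 0, e 1] := by
      rwa [← List.ofFn_inj.1 (by simp : List.ofFn e = List.ofFn ![e 0, e 1])]
    have hP := isCoord_mk (R := F)
      (smul_add_ne_zero_of_pair hpair (-((e 1).2.2 / (e 0).2.2)))
    refine ⟨_, mem_ratCurve_iff.2 (.inr ⟨-((e 1).2.2 / (e 0).2.2), ?_⟩), hP.le_infinity.2 ?_⟩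
    · simpa [Fin.sum_univ_two] using hP
    · simp [h0]

theorem le_infinity_of_mem_ratCurve {e : Fin (r + 1) → K × K × F} (he : (fun i => (e i).2.2) = 0)
    {P : Space F K} (hP : P ∈ ratCurve e) : P.submodule ≤ infinity F K := by
  obtain ⟨s, t, hP⟩ := hP
  rw [hP.le_infinity]
  simp [Prod.snd_sum, congrFun he]

variable [Finite K]

theorem IsExternalSublineImage.exists_normalized (hn : IsPrimePow (finrank F K))
    (h : IsExternalSublineImage F K k r M) :
    ∃ (E : IntermediateField F K) (u v : K × K × K), finrank F E = k ∧
      LinearIndependent K ![u, v] ∧ u.2.2 = 1 ∧ IsExternal (subline E u v) ∧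
        finrank F F⟮infParam u v⟯ = r ∧ M = abbImage F K (subline E u v) := by
  obtain ⟨_, ⟨E, u, v, hE, huv, rfl⟩, hext, hr, rfl⟩ := h
  change IsExternal (subline E u v) at hext
  obtain ⟨u', v', huv', hu', hparam, hsub⟩ :=
    exists_subline_eq_normalized (E := E) huv ((isExternal_subline_iff huv).1 hext).1
  have hr' := (smallestTangentDegree_iff_finrank_adjoin hn huv hext).1 hr
  refine ⟨E, u', v', hE, huv', hu', hsub ▸ hext, hparam ▸ hr', ?_⟩
  rw [hsub]
  rfl

theorem IsExternalSublineImage.two_le (hn : IsPrimePow (finrank F K))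
    (h : IsExternalSublineImage F K k r M) : 2 ≤ r := by
  obtain ⟨E, u, v, -, huv, -, hext, rfl, -⟩ := h.exists_normalized hn
  have hne : finrank F F⟮infParam u v⟯ ≠ 1 := fun h1 => by
    rw [IntermediateField.finrank_eq_one_iff, adjoin_simple_eq_bot_iff] at h1
    exact ((isExternal_subline_iff huv).1 hext).2 (bot_le (a := E) h1)
  have : 0 < finrank F F⟮infParam u v⟯ := finrank_pos
  omega

variable [Fintype F]

theorem IsExternalSublineImage.isSpecialCurve (hn : IsPrimePow (finrank F K))
    (h : IsExternalSublineImage F K 1 r M) : IsSpecialCurve F K r M := by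
  obtain ⟨E, u, v, hE, huv, hu, hext, hr, rfl⟩ := h.exists_normalized hn
  obtain rfl := IntermediateField.finrank_eq_one_iff.1 hE
  have hu0 : u.2.2 ≠ 0 := hu.trans_ne one_ne_zero
  have hη := ((isExternal_subline_iff huv).1 hext).2
  have hdvd : r ∣ finrank F K := hr ▸ Dvd.intro _ (finrank_mul_finrank F _ K)
  rw [adjoin.finrank (.of_finite F _)] at hr
  obtain ⟨e, he⟩ := exists_isCurveFrame hu hr
  refine ⟨e, he.linearIndependent huv, ?_, he.meetsIndicator huv hu0 hdvd⟩
  rw [abbImage_eq_preimage hext, he.ratCurve_eq hu0 hη]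

theorem IsSpecialCurve.isExternalSublineImage (hn : IsPrimePow (finrank F K))
    (hr : r ∣ finrank F K) (hr2 : 2 ≤ r) (h : IsSpecialCurve F K r M)
    (haff : ∃ P ∈ M, ¬ P.submodule ≤ infinity F K) : IsExternalSublineImage F K 1 r M := by
  obtain ⟨e, hli, rfl, hmeets⟩ := h
  obtain ⟨P, hP, hPaff⟩ := haff
  obtain ⟨u, v, hu, he⟩ := exists_isCurveFrame_of_meetsIndicator hr hr2
    (fun h0 => hPaff (le_infinity_of_mem_ratCurve h0 hP)) hmeets
  have huv := he.linearIndependent_pair hu hli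
  have hdeg : finrank F F⟮infParam u v⟯ = r := by rw [adjoin.finrank (.of_finite F _), he.1]
  have hη : infParam u v ∉ (⊥ : IntermediateField F K) := fun hmem => by
    rw [← adjoin_simple_eq_bot_iff, ← IntermediateField.finrank_eq_one_iff] at hmem
    omega
  have hext := (isExternal_subline_iff huv).2 ⟨hu, hη⟩
  refine ⟨_, ⟨⊥, u, v, IntermediateField.finrank_bot, huv, rfl⟩, hext,
    (smallestTangentDegree_iff_finrank_adjoin hn huv hext).2 hdeg, ?_⟩
  rw [he.ratCurve_eq hu hη]
  exact (abbImage_eq_preimage hext).symm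

theorem IsExternalSublineImage.spansOverSpread (hn : IsPrimePow (finrank F K))
    (hr : r ≤ Fintype.card F) (h : IsExternalSublineImage F K k r M) : SpansOverSpread F K r M := by
  obtain ⟨E, u, v, -, huv, hu, hext, rfl, rfl⟩ := h.exists_normalized hn
  exact spansOverSpread_abbImage_subline huv hu hext
    (le_adjoin_of_notMem hn ((isExternal_subline_iff huv).1 hext).2) hr

end ExternalSublineImage

section CurveClosed

open Module

variable {F K : Type*} [Field F] [Field K] [Algebra F K] {k r : ℕ} {M C C' : Set (Space F K)}
  {A B D : Space F K}

theorem toPlane_ne {m : Set (Plane K)} (hm : IsExternal m) (hA : A ∈ abbImage F K m)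
    (hB : B ∈ abbImage F K m) (hAB : A ≠ B) : toPlane F K A ≠ toPlane F K B :=
  toPlane_injOn.ne (not_le_infinity_of_mem_abbImage hm hA) (not_le_infinity_of_mem_abbImage hm hB)
    hAB

theorem IsExternalSublineImage.eq_of_three_mem (h : IsExternalSublineImage F K 1 r C)
    (h' : IsExternalSublineImage F K 1 r C') (hC : {A, B, D} ⊆ C) (hC' : {A, B, D} ⊆ C')
    (hAB : A ≠ B) (hAD : A ≠ D) (hBD : B ≠ D) : C = C' := by
  obtain ⟨_, ⟨E, u, v, hE, huv, rfl⟩, hext, -, rfl⟩ := h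
  obtain ⟨_, ⟨E', u', v', hE', huv', rfl⟩, hext', -, rfl⟩ := h'
  obtain rfl := IntermediateField.finrank_eq_one_iff.1 hE
  obtain rfl := IntermediateField.finrank_eq_one_iff.1 hE'
  simp only [Set.insert_subset_iff, Set.singleton_subset_iff] at hC hC'
  obtain ⟨hA, hB, hD⟩ := hC
  have hne := toPlane_ne hext hA hB hAB
  have hne' := toPlane_ne hext hA hD hAD
  have hne'' := toPlane_ne hext hB hD hBD
  rw [abbImage_eq_preimage hext] at hA hB hD
  rw [abbImage_eq_preimage hext'] at hC'
  exact congrArg _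
    (subline_eq_of_three_mem huv huv' hA hB hD hC'.1 hC'.2.1 hC'.2.2 hne hne' hne'')

theorem CurveClosed.ne_one [Fintype F] (h : CurveClosed F K r M)
    (hM : ∀ P ∈ M, ¬ P.submodule ≤ infinity F K)
    (hcard : 2 < M.ncard) : r ≠ 1 := by
  rintro rfl
  obtain ⟨A, B, D, hA, hB, hD, hAB, hAD, hBD⟩ :=
    (Set.two_lt_ncard_iff (Set.finite_of_ncard_pos (by omega))).1 hcard
  obtain ⟨_, ⟨⟨e, he, rfl, -⟩, -⟩, hCM, -⟩ := h A hA B hB D hD hAB hAD hBD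
  obtain ⟨P, hP, hinf⟩ := exists_mem_ratCurve_le_infinity he
  exact hM P (hCM hP) hinf

variable [Finite K]

theorem IsExternalSublineImage.exists_subset (hn : IsPrimePow (finrank F K))
    (h : IsExternalSublineImage F K k r M) (hA : A ∈ M) (hB : B ∈ M) (hD : D ∈ M) (hAB : A ≠ B)
    (hAD : A ≠ D) (hBD : B ≠ D) : ∃ C ⊆ M, {A, B, D} ⊆ C ∧ IsExternalSublineImage F K 1 r C := by
  obtain ⟨_, ⟨E, u, v, -, huv, rfl⟩, hext, hr, rfl⟩ := h
  change IsExternal (subline E u v) at hext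
  change SmallestTangentDegree F K (subline E u v) r at hr
  have hne := toPlane_ne hext hA hB hAB
  have hne' := toPlane_ne hext hA hD hAD
  have hne'' := toPlane_ne hext hB hD hBD
  change abbImage F K (subline E u v) _ at hA hB hD
  rw [abbImage_eq_preimage hext] at hA hB hD
  obtain ⟨u', v', huv', hAu, hBv, hDuv, e⟩ := exists_frame huv hA hB hD hne hne' hne''
  rw [e] at hext hr
  have hsub : subline (⊥ : IntermediateField F K) u' v' ⊆ subline E u' v' := subline_mono bot_le
  have hext' : IsExternal (subline (⊥ : IntermediateField F K) u' v') := fun P hP =>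
    hext P (hsub hP)
  refine ⟨abbImage F K (subline (⊥ : IntermediateField F K) u' v'), ?_, ?_, _,
    ⟨⊥, u', v', IntermediateField.finrank_bot, huv', rfl⟩, hext',
    (smallestTangentDegree_iff_of_subset hn huv' huv' hsub hext).2 hr, rfl⟩
  · exact Set.biUnion_subset_biUnion_left (hsub.trans_eq e.symm)
  · rw [abbImage_eq_preimage hext']
    simp only [Set.insert_subset_iff, Set.singleton_subset_iff, Set.mem_preimage, mem_subline_iff]
    exact ⟨.inl hAu, .inr ⟨0, zero_mem _, by simpa using hBv⟩,
      .inr ⟨1, one_mem _, by simpa using hDuv⟩⟩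

variable [Fintype F]

theorem IsExternalSublineImage.curveClosed (hn : IsPrimePow (finrank F K)) (hr : r ∣ finrank F K)
    (h : IsExternalSublineImage F K k r M) : CurveClosed F K r M := by
  intro A hA B hB D hD hAB hAD hBD
  obtain ⟨C, hCM, hsub, hC⟩ := h.exists_subset hn hA hB hD hAB hAD hBD
  refine ⟨C, ⟨hC.isSpecialCurve hn, hsub⟩, hCM, fun C' ⟨hC', hsub'⟩ => ?_⟩
  have haff : ∃ P ∈ C', ¬ P.submodule ≤ infinity F K := by
    obtain ⟨m, -, hext, -, rfl⟩ := h
    exact ⟨A, hsub' (Set.mem_insert A _), not_le_infinity_of_mem_abbImage hext hA⟩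
  exact (hC'.isExternalSublineImage hn hr (h.two_le hn) haff).eq_of_three_mem hC hsub' hsub
    hAB hAD hBD

theorem CurveClosed.exists_subline (hn : IsPrimePow (finrank F K)) (hr : r ∣ finrank F K)
    (hr2 : 2 ≤ r) (h : CurveClosed F K r M) (hM : ∀ P ∈ M, ¬ P.submodule ≤ infinity F K)
    {P Q T : Plane K} (hP : P ∈ toPlane F K '' M) (hQ : Q ∈ toPlane F K '' M)
    (hT : T ∈ toPlane F K '' M) (hPQ : P ≠ Q) (hPT : P ≠ T) (hQT : Q ≠ T) :
    ∃ u v, LinearIndependent K ![u, v] ∧ {P, Q, T} ⊆ subline (⊥ : IntermediateField F K) u v ∧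
      subline (⊥ : IntermediateField F K) u v ⊆ toPlane F K '' M ∧
        SmallestTangentDegree F K (subline (⊥ : IntermediateField F K) u v) r := by
  obtain ⟨A, hA, rfl⟩ := hP
  obtain ⟨B, hB, rfl⟩ := hQ
  obtain ⟨D, hD, rfl⟩ := hT
  obtain ⟨C, ⟨hC, hsub⟩, hCM, -⟩ := h A hA B hB D hD (ne_of_apply_ne _ hPQ) (ne_of_apply_ne _ hPT)
    (ne_of_apply_ne _ hQT)
  obtain ⟨_, ⟨E, u, v, hE, huv, rfl⟩, hext, hdeg, rfl⟩ :=
    hC.isExternalSublineImage hn hr hr2 ⟨A, hsub (Set.mem_insert A _), hM A hA⟩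
  obtain rfl := IntermediateField.finrank_eq_one_iff.1 hE
  refine ⟨u, v, huv, ?_, ?_, hdeg⟩
  · have himage := Set.image_mono (f := toPlane F K) hsub
    rwa [image_toPlane_abbImage hext, Set.image_insert_eq, Set.image_pair] at himage
  · exact (image_toPlane_abbImage hext).symm.subset.trans (Set.image_mono hCM)

theorem CurveClosed.isExternalSublineImage (hn : IsPrimePow (finrank F K))
    (hq : 2 < Fintype.card F) (hk : k ≠ 0) (hr : r ∣ finrank F K)
    (hcard : M.ncard = Fintype.card F ^ k + 1) (hM : ∀ P ∈ M, ¬ P.submodule ≤ infinity F K)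
    (h : CurveClosed F K r M) : IsExternalSublineImage F K k r M := by
  have hcard2 : 2 < M.ncard := by
    have := Nat.le_self_pow hk (Fintype.card F)
    omega
  have hr2 : 2 ≤ r := by
    have hr0 : 0 < r := Nat.pos_of_dvd_of_pos hr finrank_pos
    have hr1 := h.ne_one hM hcard2
    omega
  have hclosed : IsSublineClosed F (toPlane F K '' M) := fun P hP Q hQ T hT hPQ hPT hQT =>
    let ⟨u, v, huv, hsub, hle, _⟩ := h.exists_subline hn hr hr2 hM hP hQ hT hPQ hPT hQT
    ⟨u, v, huv, hsub, hle⟩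
  obtain ⟨y, hy0, hy1⟩ : ∃ y : F, y ≠ 0 ∧ y ≠ 1 := by
    classical
    obtain ⟨y, -, hy⟩ := Finset.exists_mem_notMem_of_card_lt_card
      (s := ({0, 1} : Finset F)) (t := Finset.univ) (Finset.card_le_two.trans_lt hq)
    exact ⟨y, by simpa using hy⟩
  have hcardP := ncard_image_toPlane hM
  obtain ⟨E, u, v, huv, hm⟩ := hclosed.exists_eq_subline hy0 hy1 (hcardP.symm ▸ hcard2)
  have hE : finrank F E = k := by
    rw [hm, ncard_subline huv, hcard, Module.natCard_eq_pow_finrank (K := F)] at hcardP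
    exact Nat.pow_right_injective hq.le (by simpa using hcardP)
  have hext : IsExternal (subline E u v) := hm ▸ isExternal_image_toPlane hM
  obtain ⟨P, Q, T, hP, hQ, hT, hPQ, hPT, hQT⟩ := (Set.two_lt_ncard_iff (Set.toFinite _)).1
    (hcardP.symm ▸ hcard2)
  obtain ⟨u', v', huv', -, hle, hdeg⟩ := h.exists_subline hn hr hr2 hM hP hQ hT hPQ hPT hQT
  rw [hm] at hle
  refine ⟨subline E u v, ⟨E, u, v, hE, huv, rfl⟩, hext,
    (smallestTangentDegree_iff_of_subset hn huv' huv hle hext).1 hdeg, ?_⟩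
  rw [← hm, abbImage_image_toPlane hM]

end CurveClosed

end ABB

end

open ABB in
theorem corollary2p9_general (F K : Type*) [Field F] [Fintype F] [Field K] [Finite K] [Algebra F K]
    (k r : ℕ) (hn : IsPrimePow (Module.finrank F K)) (hq : 2 < Fintype.card F) (hk : k ≠ 0)
    (hr : r ∣ Module.finrank F K) (M : Set (ABB.Space F K))
    (hcard : M.ncard = Fintype.card F ^ k + 1)
    (hM : ∀ P ∈ M, ¬ P.submodule ≤ ABB.infinity F K) :
    IsExternalSublineImage F K k r M ↔ CurveClosed F K r M :=
  ⟨fun h => h.curveClosed hn hr, fun h => h.isExternalSublineImage hn hq hk hr hcard hM⟩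

theorem corollary2p9 (F K : Type*) [Field F] [Fintype F] [Field K] [Finite K] [Algebra F K]
    (q n k r : ℕ) (hq : Fintype.card F = q) (hn : Module.finrank F K = n)
    (hnpp : IsPrimePow n) (hqn : n ≤ q) (hn2 : 2 < n) (hk : k ∣ n) (hr : r ∣ n)
    (M : Set (ABB.Space F K)) (hMcard : M.ncard = q ^ k + 1)
    (hMaff : ∀ P ∈ M, ¬ P.submodule ≤ ABB.infinity F K) :
    (∃ m : Set (ABB.Plane K), ABB.IsSubline F K k m ∧ ABB.IsExternal m ∧
        ABB.SmallestTangentDegree F K m r ∧ M = ABB.abbImage F K m) ↔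
      ABB.SpansOverSpread F K r M ∧ ABB.CurveClosed F K r M := by
  subst hq hn
  have hn0 := zero_lt_two.trans hn2
  have main := corollary2p9_general F K k r hnpp (hn2.trans_le hqn)
    (ne_zero_of_dvd_ne_zero hn0.ne' hk) hr M hMcard hMaff
  exact ⟨fun h => ⟨ABB.IsExternalSublineImage.spansOverSpread hnpp
    ((Nat.le_of_dvd hn0 hr).trans hqn) h, main.1 h⟩, fun h => main.2 h.2⟩
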